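/- **Theorem 4.8.** A Leibniz superalgebra of type $(p,m)$ is a complex $\mathbb{Z}_2$-graded vector space $L=L_0\oplus L_1$ with $\dim L_0=p$, $\dim L_1=m$, and a bilinear product satisfying $[L_\alpha,L_\beta]\subseteq L_{\alpha+\beta}$ and the graded Leibniz identity $$[x,[y,z]]=[[x,y],z]-(-1)^{\alpha\beta}[[x,z],y]\qquad (x\in L,\ y\in L_\alpha,\ z\in L_\beta).$$ It is nilpotent if $C^k(L)=0$ for some $k$, where $C^0(L)=L$ and $C^{k+1}(L)=[C^k(L),L]$. Let $N^{p,m}$ be the set of nilpotent Leibniz superalgebra laws on a fixed graded space $V=V_0\oplus V_1$ of type $(p,m)$, with the topology induced by the Zariski topology of the affine space of structure constants in a homogeneous basis. Let $O(\lambda)$ denote the orbit of a law $\lambda$ under $GL(V_0)\times GL(V_1)$, where $f=f_0+f_1$ sends $\lambda$ to the law $(x,y)\mapsto f^{-1}(\lambda(f(x),f(y)))$. Let $n\ge 2$, let $\{X_0,\dots,X_n\}$ be a basis of $V_0$ and $\{Y_1,Y_2\}$ a basis of $V_1$, and let $\mu_2,\mu_3$ be the laws of type $(n+1,2)$ given by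 $$\mu_2:\quad [X_i,X_0]=X_{i+1}\ (0\le i\le n-1),\quad [Y_1,X_0]=Y_2,\quad [Y_1,Y_1]=X_{n-1},\quad [Y_2,Y_1]=X_n;$$ $$\mu_3:\quad [X_i,X_0]=X_{i+1}\ (0\le i\le n-1),\quad [Y_1,X_0]=Y_2,\quad [X_0,Y_1]=-Y_2,\quad [Y_1,Y_1]=X_{n-1},\quad [Y_1,Y_2]=X_n;$$ all omitted products of basis vectors are zero. Then $O(\mu_2)$ and $O(\mu_3)$ are contained in $N^{n+1,2}$ and are Zariski open subsets of $N^{n+1,2}$ (that is, $\mu_2$ and $\mu_3$ are rigid), and the closures of these two orbits in $N^{n+1,2}$ are irreducible components of $N^{n+1,2}$. -/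

import Mathlib

namespace LeibnizSuper

/-- Indices of the structure constants of a graded product on a space of type `(n, m)` with
homogeneous basis `X_0, …, X_{n-1}` (even) and `Y_1, …, Y_m` (odd, indexed here by `0, …, m-1`):
the coefficient of the `k`-th basis vector in `[X_i, X_j]`, `[X_i, Y_j]`, `[Y_i, X_j]` and
`[Y_i, Y_j]` respectively. -/
inductive StructIndex (n m : ℕ) : Type
  | xx (i j k : Fin n)
  | xy (i : Fin n) (j k : Fin m)
  | yx (i : Fin m) (j : Fin n) (k : Fin m)
  | yy (i j : Fin m) (k : Fin n)

/-- The affine space of all products `[V_α, V_β] ⊆ V_{α+β}` on the graded space of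
type `(n, m)`, given by their structure constants. -/
def Law (n m : ℕ) : Type := StructIndex n m → ℂ

/-- A set of laws is algebraic if it is the common zero set of a set of polynomials in the
structure constants. -/
def IsAlgebraicSet {n m : ℕ} (Z : Set (Law n m)) : Prop :=
  ∃ S : Set (MvPolynomial (StructIndex n m) ℂ),
    Z = {l : Law n m | ∀ p ∈ S, MvPolynomial.eval (l : StructIndex n m → ℂ) p = 0}

/-- The Zariski topology on the affine space of laws: the closed sets are the algebraic sets. -/
instance zariskiTopology (n m : ℕ) : TopologicalSpace (Law n m) :=
  TopologicalSpace.ofClosed {Z : Set (Law n m) | IsAlgebraicSet Z}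
    ⟨{1}, by ext l; simp⟩
    (by
      intro A hA
      refine ⟨{p | ∃ Z ∈ A, ∀ l ∈ Z, MvPolynomial.eval (l : StructIndex n m → ℂ) p = 0}, ?_⟩
      ext l
      constructor
      · rintro hl p ⟨Z, hZ, hp⟩
        exact hp l (hl Z hZ)
      · intro hl Z hZ
        obtain ⟨S, rfl⟩ := hA hZ
        intro p hp
        exact hl p ⟨_, hZ, fun l' hl' => hl' p hp⟩)
    (by
      rintro _ ⟨S, rfl⟩ _ ⟨T, rfl⟩
      refine ⟨{r | ∃ p ∈ S, ∃ q ∈ T, r = p * q}, ?_⟩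
      ext l
      constructor
      · rintro (h | h) r ⟨p, hp, q, hq, rfl⟩
        · rw [map_mul, h p hp, zero_mul]
        · rw [map_mul, h q hq, mul_zero]
      · intro h
        by_contra hc
        rw [Set.mem_union, not_or] at hc
        obtain ⟨h1, h2⟩ := hc
        simp only [Set.mem_ofPred_eq, not_forall] at h1 h2
        obtain ⟨p, hp, hp0⟩ := h1
        obtain ⟨q, hq, hq0⟩ := h2
        have := h (p * q) ⟨p, hp, q, hq, rfl⟩
        rw [map_mul] at this
        exact (mul_ne_zero hp0 hq0) this)

/-- The underlying graded space `V = V_0 ⊕ V_1` with `dim V_0 = n`, `dim V_1 = m`. -/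
abbrev V (n m : ℕ) : Type := (Fin n → ℂ) × (Fin m → ℂ)

/-- The homogeneous components of `V`. -/
def homogeneous (n m : ℕ) (α : ZMod 2) : Submodule ℂ (V n m) :=
  if α = 0 then Submodule.prod ⊤ ⊥ else Submodule.prod ⊥ ⊤

theorem mem_homogeneous_zero {n m : ℕ} {x : V n m} : x ∈ homogeneous n m 0 ↔ x.2 = 0 := by
  simp [homogeneous]

theorem mem_homogeneous_one {n m : ℕ} {x : V n m} : x ∈ homogeneous n m 1 ↔ x.1 = 0 := by
  simp [homogeneous]

/-- The bilinear product on `V` with the given structure constants. -/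
def Law.bracket {n m : ℕ} (l : Law n m) : V n m →ₗ[ℂ] V n m →ₗ[ℂ] V n m :=
  LinearMap.mk₂ ℂ
    (fun x y =>
      (fun k => (∑ i, ∑ j, x.1 i * y.1 j * l (.xx i j k)) + ∑ i, ∑ j, x.2 i * y.2 j * l (.yy i j k),
       fun k => (∑ i, ∑ j, x.1 i * y.2 j * l (.xy i j k)) + ∑ i, ∑ j, x.2 i * y.1 j * l (.yx i j k)))
    (by
      intro x x' y
      ext k <;> simp [add_mul, Finset.sum_add_distrib] <;> ring)
    (by
      intro c x y
      ext k <;> simp [mul_add, Finset.mul_sum, mul_assoc])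
    (by
      intro x y y'
      ext k <;> simp [add_mul, mul_add, Finset.sum_add_distrib] <;> ring)
    (by
      intro c x y
      ext k <;> simp [mul_add, Finset.mul_sum, mul_assoc, mul_left_comm])

/-- The graded Leibniz identity. The product of a law is even by construction. -/
def Law.IsLeibniz {n m : ℕ} (l : Law n m) : Prop :=
  ∀ (α β : ZMod 2) (x y z : V n m), y ∈ homogeneous n m α → z ∈ homogeneous n m β →
    l.bracket x (l.bracket y z) =
      l.bracket (l.bracket x y) z - (-1 : ℂ) ^ (α.val * β.val) • l.bracket (l.bracket x z) y

/-- The descending central sequence `C^0(L) = L`, `C^{k+1}(L) = [C^k(L), L]`. -/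
def Law.centralSeries {n m : ℕ} (l : Law n m) : ℕ → Submodule ℂ (V n m)
  | 0 => ⊤
  | k + 1 => Submodule.map₂ l.bracket (l.centralSeries k) ⊤

/-- The law is nilpotent. -/
def Law.IsNilpotent {n m : ℕ} (l : Law n m) : Prop :=
  ∃ k : ℕ, l.centralSeries k = ⊥

/-- The variety of nilpotent Leibniz superalgebras of type `(n, m)`. -/
def nilpotentVariety (n m : ℕ) : Set (Law n m) :=
  {l | l.IsLeibniz ∧ l.IsNilpotent}

/-- The orbit of a law under `GL(V_0) × GL(V_1)`, which acts by change of basis. -/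
def Law.orbit {n m : ℕ} (l : Law n m) : Set (Law n m) :=
  {l' | ∃ (f₀ : (Fin n → ℂ) ≃ₗ[ℂ] (Fin n → ℂ)) (f₁ : (Fin m → ℂ) ≃ₗ[ℂ] (Fin m → ℂ)),
    ∀ x y : V n m,
      l'.bracket x y =
        (f₀.prodCongr f₁).symm (l.bracket ((f₀.prodCongr f₁) x) ((f₀.prodCongr f₁) y))}

/-- The orbit of a law as a subset of the variety of nilpotent Leibniz superalgebras, which
carries the topology induced by the Zariski topology. -/
def Law.orbitInVariety {n m : ℕ} (l : Law n m) : Set (nilpotentVariety n m) :=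
  Subtype.val ⁻¹' l.orbit

/-- The law `μ₂` of type `(n + 1, 2)`:
`[X_i, X_0] = X_{i+1}` for `0 ≤ i ≤ n - 1`, `[Y_1, X_0] = Y_2`, `[Y_1, Y_1] = X_{n-1}`,
`[Y_2, Y_1] = X_n`, all other products of basis vectors being zero. -/
def mu2 (n : ℕ) : Law (n + 1) 2
  | .xx i j k => if j = 0 ∧ (k : ℕ) = i + 1 then 1 else 0
  | .xy _ _ _ => 0
  | .yx i j k => if i = 0 ∧ j = 0 ∧ k = 1 then 1 else 0
  | .yy i j k =>
      if (i = 0 ∧ j = 0 ∧ (k : ℕ) + 1 = n) ∨ (i = 1 ∧ j = 0 ∧ (k : ℕ) = n) then 1 else 0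

/-- The law `μ₃` of type `(n + 1, 2)`:
`[X_i, X_0] = X_{i+1}` for `0 ≤ i ≤ n - 1`, `[Y_1, X_0] = Y_2`, `[X_0, Y_1] = -Y_2`,
`[Y_1, Y_1] = X_{n-1}`, `[Y_1, Y_2] = X_n`, all other products of basis vectors being zero. -/
def mu3 (n : ℕ) : Law (n + 1) 2
  | .xx i j k => if j = 0 ∧ (k : ℕ) = i + 1 then 1 else 0
  | .xy i j k => if i = 0 ∧ j = 0 ∧ k = 1 then -1 else 0
  | .yx i j k => if i = 0 ∧ j = 0 ∧ k = 1 then 1 else 0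
  | .yy i j k =>
      if (i = 0 ∧ j = 0 ∧ (k : ℕ) + 1 = n) ∨ (i = 0 ∧ j = 1 ∧ (k : ℕ) = n) then 1 else 0

end LeibnizSuper

/-!
Every orbit is irreducible, being the image of a basic open subset of an affine space under a
polynomial map: an orbit is closed under nonzero scalars, so the inverse matrices of the action may
be replaced by multiples of adjugates. An irreducible open subset of `N^{n+1,2}` has as closure an
irreducible component, so it remains to see that the two orbits are open.

Inside `N^{n+1,2}` the orbit of `μ₂` consists of the laws for which there are an even `x` and an odd
`y` such that the left-normed power `[…[x, x], …, x]` of length `n + 1`, the product `z = [y, x]`,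
and `[z, y]` are all nonzero; for `μ₃`, the product `[z, y]` is replaced by `[y, z]`. These are open
conditions. That they are sufficient follows from the Leibniz identity and nilpotency: the powers of
`x` together with `y` and `z` form a basis, and its multiplication table is determined up to the
coefficient `b` of `[x, y] = b z` and the product `[y, y]`. The condition forces `b = 0` or `b = -1`
respectively, and replacing `x` and `y` by `s x + t [x, x]` and `r y` brings `[y, y]` into the
form `X_{n-1}`.
-/

namespace LeibnizSuper

open scoped Matrix

section Bracket

variable {n m : ℕ}

theorem Law.bracket_apply (l : Law n m) (x y : V n m) :
    l.bracket x y =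
      (fun k => (∑ i, ∑ j, x.1 i * y.1 j * l (.xx i j k)) + ∑ i, ∑ j, x.2 i * y.2 j * l (.yy i j k),
       fun k => (∑ i, ∑ j, x.1 i * y.2 j * l (.xy i j k)) +
         ∑ i, ∑ j, x.2 i * y.1 j * l (.yx i j k)) :=
  rfl

variable {l : Law n m} {x y : V n m}

theorem Law.bracket_snd_of_even_even (hx : x.2 = 0) (hy : y.2 = 0) : (l.bracket x y).2 = 0 := by
  ext k
  simp [Law.bracket_apply, hx, hy]

theorem Law.bracket_snd_of_odd_odd (hx : x.1 = 0) (hy : y.1 = 0) : (l.bracket x y).2 = 0 := by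
  ext k
  simp [Law.bracket_apply, hx, hy]

theorem Law.bracket_fst_of_even_odd (hx : x.2 = 0) (hy : y.1 = 0) : (l.bracket x y).1 = 0 := by
  ext k
  simp [Law.bracket_apply, hx, hy]

theorem Law.bracket_fst_of_odd_even (hx : x.1 = 0) (hy : y.2 = 0) : (l.bracket x y).1 = 0 := by
  ext k
  simp [Law.bracket_apply, hx, hy]

variable {ι₀ ι₁ M : Type*} [AddCommMonoid M] [Module ℂ M]

theorem bilinear_ext_basis (b₀ : Module.Basis ι₀ ℂ (Fin n → ℂ)) (b₁ : Module.Basis ι₁ ℂ (Fin m → ℂ))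
    {B C : V n m →ₗ[ℂ] V n m →ₗ[ℂ] M}
    (h₀₀ : ∀ i j, B (b₀ i, 0) (b₀ j, 0) = C (b₀ i, 0) (b₀ j, 0))
    (h₀₁ : ∀ i j, B (b₀ i, 0) (0, b₁ j) = C (b₀ i, 0) (0, b₁ j))
    (h₁₀ : ∀ i j, B (0, b₁ i) (b₀ j, 0) = C (0, b₁ i) (b₀ j, 0))
    (h₁₁ : ∀ i j, B (0, b₁ i) (0, b₁ j) = C (0, b₁ i) (0, b₁ j)) :
    B = C :=
  LinearMap.prod_ext
    (b₀.ext fun i => LinearMap.prod_ext (b₀.ext (h₀₀ i)) (b₁.ext (h₀₁ i)))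
    (b₁.ext fun i => LinearMap.prod_ext (b₀.ext (h₁₀ i)) (b₁.ext (h₁₁ i)))

/-- The law whose structure constants are the homogeneous parts of the values of a bilinear map on
the standard basis. -/
def Law.ofBilinear (B : V n m →ₗ[ℂ] V n m →ₗ[ℂ] V n m) : Law n m
  | .xx i j k => (B (Pi.single i 1, 0) (Pi.single j 1, 0)).1 k
  | .xy i j k => (B (Pi.single i 1, 0) (0, Pi.single j 1)).2 k
  | .yx i j k => (B (0, Pi.single i 1) (Pi.single j 1, 0)).2 k
  | .yy i j k => (B (0, Pi.single i 1) (0, Pi.single j 1)).1 k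

theorem Law.ofBilinear_bracket (l : Law n m) : Law.ofBilinear l.bracket = l := by
  funext s
  cases s <;> simp [Law.ofBilinear, Law.bracket_apply, Pi.single_apply]

theorem Law.bracket_injective : Function.Injective (Law.bracket (n := n) (m := m)) :=
  Function.LeftInverse.injective Law.ofBilinear_bracket

theorem Law.bracket_ofBilinear {B : V n m →ₗ[ℂ] V n m →ₗ[ℂ] V n m}
    (h₀₀ : ∀ a b, (B (a, 0) (b, 0)).2 = 0) (h₀₁ : ∀ a b, (B (a, 0) (0, b)).1 = 0)
    (h₁₀ : ∀ a b, (B (0, a) (b, 0)).1 = 0) (h₁₁ : ∀ a b, (B (0, a) (0, b)).2 = 0) :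
    (Law.ofBilinear B).bracket = B := by
  refine bilinear_ext_basis (Pi.basisFun ℂ _) (Pi.basisFun ℂ _) (fun i j => ?_) (fun i j => ?_)
    (fun i j => ?_) (fun i j => ?_) <;>
  · ext k <;> simp [Law.bracket_apply, Law.ofBilinear, Pi.single_apply, h₀₀, h₀₁, h₁₀, h₁₁]

end Bracket

section PolynomialFunctions

variable {σ T R : Type*} [CommRing R]

/-- The polynomial functions on the affine space `σ → R`. -/
noncomputable def polynomialFunctions (σ R : Type*) [CommRing R] : Subalgebra R ((σ → R) → R) :=
  (MvPolynomial.aeval fun (s : σ) (x : σ → R) => x s).range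

theorem mem_polynomialFunctions {f : (σ → R) → R} :
    f ∈ polynomialFunctions σ R ↔ ∃ p : MvPolynomial σ R, ∀ x, f x = MvPolynomial.eval x p := by
  have aeval_apply (p : MvPolynomial σ R) (x : σ → R) :
      MvPolynomial.aeval (fun (s : σ) (x : σ → R) => x s) p x = MvPolynomial.eval x p := by
    induction p using MvPolynomial.induction_on with
    | C a => simp
    | add p q hp hq => simp [hp, hq]
    | mul_X p s hp => simp [hp]
  exact ⟨fun ⟨p, hp⟩ => ⟨p, fun x => hp ▸ aeval_apply p x⟩,
    fun ⟨p, hp⟩ => ⟨p, funext fun x => (aeval_apply p x).trans (hp x).symm⟩⟩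

theorem coord_mem_polynomialFunctions (s : σ) :
    (fun x : σ → R => x s) ∈ polynomialFunctions σ R :=
  mem_polynomialFunctions.2 ⟨.X s, fun _ => (MvPolynomial.eval_X s).symm⟩

theorem comp_mem_of_mem_polynomialFunctions {A : Subalgebra R (T → R)} {Φ : T → σ → R}
    (hΦ : ∀ s, (fun t => Φ t s) ∈ A) {f : (σ → R) → R} (hf : f ∈ polynomialFunctions σ R) :
    f ∘ Φ ∈ A := by
  obtain ⟨p, hp⟩ := mem_polynomialFunctions.1 hf
  have h : f ∘ Φ = fun t => MvPolynomial.eval (Φ t) p := funext fun t => hp (Φ t)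
  rw [h]
  clear h hp
  induction p using MvPolynomial.induction_on with
  | C a =>
    simp only [MvPolynomial.eval_C]
    exact A.algebraMap_mem a
  | add p q hp hq =>
    simp only [map_add]
    exact add_mem hp hq
  | mul_X p s hp =>
    simp only [map_mul, MvPolynomial.eval_X]
    exact mul_mem hp (hΦ s)

theorem mul_ne_zero_of_mem_polynomialFunctions [IsDomain R] [Infinite R] {f g : (σ → R) → R}
    (hf : f ∈ polynomialFunctions σ R) (hg : g ∈ polynomialFunctions σ R) (hf0 : f ≠ 0)
    (hg0 : g ≠ 0) : f * g ≠ 0 := by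
  obtain ⟨p, hp⟩ := mem_polynomialFunctions.1 hf
  obtain ⟨q, hq⟩ := mem_polynomialFunctions.1 hg
  intro h
  have hpq : p * q = 0 := MvPolynomial.funext fun x => by
    simpa [hp, hq] using congrFun h x
  rcases mul_eq_zero.1 hpq with rfl | rfl
  · exact hf0 (funext fun x => by simp [hp])
  · exact hg0 (funext fun x => by simp [hq])

variable {A : Subalgebra R (T → R)} {d : Type*} [Fintype d]

theorem det_mem [DecidableEq d] {M : T → Matrix d d R} (hM : ∀ i j, (fun t => M t i j) ∈ A) :
    (fun t => (M t).det) ∈ A := by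
  let N : Matrix d d A := .of fun i j => ⟨fun t => M t i j, hM i j⟩
  have hN : (fun t => (M t).det) = N.det :=
    funext fun t => (((Pi.evalRingHom (fun _ => R) t).comp (A.val : A →+* T → R)).map_det N).symm
  exact hN ▸ N.det.2

theorem adjugate_mem [DecidableEq d] {M : T → Matrix d d R} (hM : ∀ i j, (fun t => M t i j) ∈ A)
    (i j : d) : (fun t => (M t).adjugate i j) ∈ A := by
  let N : Matrix d d A := .of fun i j => ⟨fun t => M t i j, hM i j⟩
  have hN : (fun t => (M t).adjugate i j) = N.adjugate i j := funext fun t =>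
    (congrFun₂ (((Pi.evalRingHom (fun _ => R) t).comp (A.val : A →+* T → R)).map_adjugate N)
      i j).symm
  exact hN ▸ (N.adjugate i j).2

theorem mulVec_mem {M : T → Matrix d d R} {v : T → d → R} (hM : ∀ i j, (fun t => M t i j) ∈ A)
    (hv : ∀ j, (fun t => v t j) ∈ A) (i : d) : (fun t => (M t *ᵥ v t) i) ∈ A := by
  have h : (fun t => (M t *ᵥ v t) i) = ∑ j, (fun t => M t i j) * fun t => v t j := by
    ext t
    simp [Matrix.mulVec, dotProduct]
  exact h ▸ sum_mem fun j _ => mul_mem (hM i j) (hv j)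

end PolynomialFunctions

section HasCoordinatesIn

variable {T : Type*} {n m : ℕ} {A : Subalgebra ℂ (T → ℂ)} {F G : T → V n m}

/-- The coordinates of a family of vectors of `V`, as functions of the parameter, lie in `A`. -/
def HasCoordinatesIn (A : Subalgebra ℂ (T → ℂ)) (F : T → V n m) : Prop :=
  (∀ k, (fun t => (F t).1 k) ∈ A) ∧ ∀ k, (fun t => (F t).2 k) ∈ A

theorem HasCoordinatesIn.const (A : Subalgebra ℂ (T → ℂ)) (v : V n m) :
    HasCoordinatesIn A fun _ => v :=
  ⟨fun k => A.algebraMap_mem (v.1 k), fun k => A.algebraMap_mem (v.2 k)⟩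

theorem HasCoordinatesIn.prodMap_mulVec (hF : HasCoordinatesIn A F)
    {M₀ : T → Matrix (Fin n) (Fin n) ℂ} {M₁ : T → Matrix (Fin m) (Fin m) ℂ}
    (h₀ : ∀ i j, (fun t => M₀ t i j) ∈ A) (h₁ : ∀ i j, (fun t => M₁ t i j) ∈ A) :
    HasCoordinatesIn A fun t => (M₀ t).toLin'.prodMap (M₁ t).toLin' (F t) :=
  ⟨mulVec_mem h₀ hF.1, mulVec_mem h₁ hF.2⟩

theorem sum_sum_mul_mem {ι κ : Type*} [Fintype ι] [Fintype κ] {f : ι → T → ℂ} {g : κ → T → ℂ}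
    {c : ι → κ → T → ℂ} (hf : ∀ i, f i ∈ A) (hg : ∀ j, g j ∈ A) (hc : ∀ i j, c i j ∈ A) :
    (fun t => ∑ i, ∑ j, f i t * g j t * c i j t) ∈ A := by
  have h : (fun t => ∑ i, ∑ j, f i t * g j t * c i j t) = ∑ i, ∑ j, f i * g j * c i j := by
    ext t
    simp
  exact h ▸ sum_mem fun i _ => sum_mem fun j _ => mul_mem (mul_mem (hf i) (hg j)) (hc i j)

theorem HasCoordinatesIn.bracket {l : T → Law n m} (hl : ∀ s, (fun t => l t s) ∈ A)
    (hF : HasCoordinatesIn A F) (hG : HasCoordinatesIn A G) :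
    HasCoordinatesIn A fun t => (l t).bracket (F t) (G t) :=
  ⟨fun k => add_mem (sum_sum_mul_mem hF.1 hG.1 fun i j => hl (.xx i j k))
      (sum_sum_mul_mem hF.2 hG.2 fun i j => hl (.yy i j k)),
    fun k => add_mem (sum_sum_mul_mem hF.1 hG.2 fun i j => hl (.xy i j k))
      (sum_sum_mul_mem hF.2 hG.1 fun i j => hl (.yx i j k))⟩

end HasCoordinatesIn

section ZariskiTopology

variable {n m : ℕ}

theorem isClosed_iff_isAlgebraicSet {Z : Set (Law n m)} : IsClosed Z ↔ IsAlgebraicSet Z := by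
  rw [← isOpen_compl_iff]
  change IsAlgebraicSet Zᶜᶜ ↔ _
  rw [compl_compl]

theorem isOpen_ne_zero {f : Law n m → ℂ} (hf : f ∈ polynomialFunctions (StructIndex n m) ℂ) :
    IsOpen {l | f l ≠ 0} := by
  obtain ⟨p, hp⟩ := mem_polynomialFunctions.1 hf
  rw [← isClosed_compl_iff, isClosed_iff_isAlgebraicSet]
  exact ⟨{p}, by ext l; simpa using (hp l).congr_left⟩

theorem exists_basicOpen_subset {U : Set (Law n m)} (hU : IsOpen U) {l : Law n m} (hl : l ∈ U) :
    ∃ f ∈ polynomialFunctions (StructIndex n m) ℂ, f l ≠ 0 ∧ {l' : Law n m | f l' ≠ 0} ⊆ U := by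
  obtain ⟨S, hS⟩ := isClosed_iff_isAlgebraicSet.1 hU.isClosed_compl
  have mem_U_iff (l' : Law n m) :
      l' ∈ U ↔ ∃ p ∈ S, MvPolynomial.eval (l' : StructIndex n m → ℂ) p ≠ 0 := by
    rw [← not_iff_not, ← Set.mem_compl_iff, hS]
    simp
  obtain ⟨p, hpS, hp⟩ := (mem_U_iff l).1 hl
  exact ⟨fun x => MvPolynomial.eval x p, mem_polynomialFunctions.2 ⟨p, fun _ => rfl⟩, hp,
    fun l' hl' => (mem_U_iff l').2 ⟨p, hpS, hl'⟩⟩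

theorem HasCoordinatesIn.isOpen_ne_zero {F : Law n m → V n m}
    (hF : HasCoordinatesIn (polynomialFunctions (StructIndex n m) ℂ) F) :
    IsOpen {l | F l ≠ 0} := by
  have h : {l | F l ≠ 0} = (⋃ k, {l | (F l).1 k ≠ 0}) ∪ ⋃ k, {l | (F l).2 k ≠ 0} := by
    ext l
    simp only [Set.mem_union, Set.mem_iUnion, Set.mem_ofPred_eq, ne_eq, Prod.ext_iff, funext_iff,
      not_and_or, not_forall, Prod.fst_zero, Prod.snd_zero, Pi.zero_apply]
  rw [h]
  exact (isOpen_iUnion fun k => LeibnizSuper.isOpen_ne_zero (hF.1 k)).union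
    (isOpen_iUnion fun k => LeibnizSuper.isOpen_ne_zero (hF.2 k))

theorem isPreirreducible_image_basicOpen {σ : Type*} {Φ : (σ → ℂ) → Law n m}
    (hΦ : ∀ s, (fun t => Φ t s) ∈ polynomialFunctions σ ℂ) {Q : (σ → ℂ) → ℂ}
    (hQ : Q ∈ polynomialFunctions σ ℂ) : IsPreirreducible (Φ '' {t | Q t ≠ 0}) := by
  rintro U W hU hW ⟨_, ⟨t, ht, rfl⟩, htU⟩ ⟨_, ⟨u, _, rfl⟩, huW⟩
  obtain ⟨f, hf, hft, hfU⟩ := exists_basicOpen_subset hU htU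
  obtain ⟨g, hg, hgu, hgW⟩ := exists_basicOpen_subset hW huW
  have hfΦ : f ∘ Φ ∈ polynomialFunctions σ ℂ := comp_mem_of_mem_polynomialFunctions hΦ hf
  have hgΦ : g ∘ Φ ∈ polynomialFunctions σ ℂ := comp_mem_of_mem_polynomialFunctions hΦ hg
  have ne_zero_of_apply {h : (σ → ℂ) → ℂ} {t : σ → ℂ} (ht : h t ≠ 0) : h ≠ 0 :=
    fun h0 => ht (congrFun h0 t)
  obtain ⟨v, hv⟩ := Function.ne_iff.1 <| mul_ne_zero_of_mem_polynomialFunctions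
    (mul_mem hfΦ hgΦ) hQ (mul_ne_zero_of_mem_polynomialFunctions hfΦ hgΦ (ne_zero_of_apply hft)
      (ne_zero_of_apply hgu)) (ne_zero_of_apply ht)
  have hfgv : f (Φ v) * g (Φ v) ≠ 0 := left_ne_zero_of_mul hv
  exact ⟨Φ v, ⟨v, right_ne_zero_of_mul hv, rfl⟩, hfU (left_ne_zero_of_mul hfgv),
    hgW (right_ne_zero_of_mul hfgv)⟩

end ZariskiTopology

section OrbitIrreducible

variable {n m : ℕ}

/-- The law `(x, y) ↦ h (l (f x, f y))`, where the even maps `f` and `h` have matrices `(A₀, A₁)`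
and `(B₀, B₁)`. -/
def Law.transport (l : Law n m) (A₀ B₀ : Matrix (Fin n) (Fin n) ℂ)
    (A₁ B₁ : Matrix (Fin m) (Fin m) ℂ) : Law n m :=
  .ofBilinear ((l.bracket.compl₁₂ (A₀.toLin'.prodMap A₁.toLin')
    (A₀.toLin'.prodMap A₁.toLin')).compr₂ (B₀.toLin'.prodMap B₁.toLin'))

variable {l l' : Law n m} {A₀ B₀ : Matrix (Fin n) (Fin n) ℂ} {A₁ B₁ : Matrix (Fin m) (Fin m) ℂ}

theorem Law.transport_bracket (x y : V n m) :
    (l.transport A₀ B₀ A₁ B₁).bracket x y =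
      (B₀.toLin'.prodMap B₁.toLin')
        (l.bracket (A₀.toLin'.prodMap A₁.toLin' x) (A₀.toLin'.prodMap A₁.toLin' y)) := by
  rw [Law.transport, Law.bracket_ofBilinear]
  · rfl
  all_goals
    intro a b
    simp [Law.bracket_snd_of_even_even, Law.bracket_fst_of_even_odd, Law.bracket_fst_of_odd_even,
      Law.bracket_snd_of_odd_odd]

-- The orbit is a cone, so it is enough that `f` and `h` are inverse to each other up to a scalar.
theorem Law.transport_mem_orbit {r : ℂ} (hr : r ≠ 0) (h₀ : A₀ * B₀ = r • 1)
    (h₁ : A₁ * B₁ = r • 1) : l.transport A₀ B₀ A₁ B₁ ∈ l.orbit := by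
  have smul_mul_smul_eq_one {d : ℕ} {A B : Matrix (Fin d) (Fin d) ℂ} (h : A * B = r • 1) :
      (r • A) * ((r ^ 2)⁻¹ • B) = 1 := by
    rw [Matrix.smul_mul, Matrix.mul_smul, h, smul_smul, smul_smul]
    field_simp
    exact one_smul ℂ _
  have inv₀ := smul_mul_smul_eq_one h₀
  have inv₁ := smul_mul_smul_eq_one h₁
  refine ⟨Matrix.toLin'OfInv (mul_eq_one_comm.1 inv₀) inv₀,
    Matrix.toLin'OfInv (mul_eq_one_comm.1 inv₁) inv₁, fun x y => ?_⟩
  change _ = ((r ^ 2)⁻¹ • B₀).toLin'.prodMap ((r ^ 2)⁻¹ • B₁).toLin'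
    (l.bracket ((r • A₀).toLin'.prodMap (r • A₁).toLin' x)
      ((r • A₀).toLin'.prodMap (r • A₁).toLin' y))
  simp only [map_smul, LinearMap.prodMap_smul, LinearMap.smul_apply, Law.transport_bracket,
    smul_smul]
  field_simp
  exact (one_smul ℂ _).symm

theorem Law.exists_transport_eq_of_mem_orbit (h : l' ∈ l.orbit) :
    ∃ (A₀ B₀ : Matrix (Fin n) (Fin n) ℂ) (A₁ B₁ : Matrix (Fin m) (Fin m) ℂ),
      A₀ * B₀ = 1 ∧ A₁ * B₁ = 1 ∧ l' = l.transport A₀ B₀ A₁ B₁ := by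
  obtain ⟨f₀, f₁, h⟩ := h
  refine ⟨f₀.toLinearMap.toMatrix', f₀.symm.toLinearMap.toMatrix', f₁.toLinearMap.toMatrix',
    f₁.symm.toLinearMap.toMatrix', ?_, ?_,
    Law.bracket_injective (LinearMap.ext₂ fun x y => ?_)⟩
  · simp [← LinearMap.toMatrix'_comp]
  · simp [← LinearMap.toMatrix'_comp]
  · rw [h, Law.transport_bracket]
    simp only [Matrix.toLin'_toMatrix']
    rfl

theorem Law.transport_mem {T : Type*} {A : Subalgebra ℂ (T → ℂ)} (l : Law n m)
    {A₀ B₀ : T → Matrix (Fin n) (Fin n) ℂ} {A₁ B₁ : T → Matrix (Fin m) (Fin m) ℂ}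
    (hA₀ : ∀ i j, (fun t => A₀ t i j) ∈ A) (hB₀ : ∀ i j, (fun t => B₀ t i j) ∈ A)
    (hA₁ : ∀ i j, (fun t => A₁ t i j) ∈ A) (hB₁ : ∀ i j, (fun t => B₁ t i j) ∈ A)
    (s : StructIndex n m) : (fun t => l.transport (A₀ t) (B₀ t) (A₁ t) (B₁ t) s) ∈ A := by
  have key (x y : V n m) : HasCoordinatesIn A fun t =>
      (B₀ t).toLin'.prodMap (B₁ t).toLin' (l.bracket ((A₀ t).toLin'.prodMap (A₁ t).toLin' x)
        ((A₀ t).toLin'.prodMap (A₁ t).toLin' y)) :=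
    (HasCoordinatesIn.bracket (l := fun _ => l) (fun s => A.algebraMap_mem (l s))
    ((HasCoordinatesIn.const A x).prodMap_mulVec hA₀ hA₁)
    ((HasCoordinatesIn.const A y).prodMap_mulVec hA₀ hA₁)).prodMap_mulVec hB₀ hB₁
  cases s with
  | xx i j k => exact (key (Pi.single i 1, 0) (Pi.single j 1, 0)).1 k
  | xy i j k => exact (key (Pi.single i 1, 0) (0, Pi.single j 1)).2 k
  | yx i j k => exact (key (0, Pi.single i 1) (Pi.single j 1, 0)).2 k
  | yy i j k => exact (key (0, Pi.single i 1) (0, Pi.single j 1)).1 k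

/-- Indices of the coordinates of the parameter space of an orbit: the entries of a matrix on `V₀`,
those of a matrix on `V₁`, and one more scalar. -/
inductive ParamIndex (n m : ℕ) : Type
  | even (i j : Fin n)
  | odd (i j : Fin m)
  | scale

/-- The matrix on `V₀` belonging to a parameter. -/
def evenMatrix (t : ParamIndex n m → ℂ) : Matrix (Fin n) (Fin n) ℂ := .of fun i j => t (.even i j)

/-- The matrix on `V₁` belonging to a parameter. -/
def oddMatrix (t : ParamIndex n m → ℂ) : Matrix (Fin m) (Fin m) ℂ := .of fun i j => t (.odd i j)

/-- The scalar by which the two matrices of `orbitParam` on each of `V₀` and `V₁` differ from being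
inverse to each other. -/
noncomputable def paramDet (t : ParamIndex n m → ℂ) : ℂ :=
  t .scale * (evenMatrix t).det * (oddMatrix t).det

/-- The polynomial parametrization of the orbit of `l` by the parameters with `paramDet ≠ 0`: the
inverse matrices of the action are replaced by multiples of the adjugates. -/
noncomputable def Law.orbitParam (l : Law n m) (t : ParamIndex n m → ℂ) : Law n m :=
  l.transport
    (evenMatrix t) ((t .scale * (oddMatrix t).det) • (evenMatrix t).adjugate)
    (oddMatrix t) ((t .scale * (evenMatrix t).det) • (oddMatrix t).adjugate)

theorem Law.orbitParam_mem_orbit {t : ParamIndex n m → ℂ} (ht : paramDet t ≠ 0) :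
    l.orbitParam t ∈ l.orbit := by
  refine Law.transport_mem_orbit ht ?_ ?_
  · rw [Matrix.mul_smul, Matrix.mul_adjugate, smul_smul, paramDet, mul_right_comm]
  · rw [Matrix.mul_smul, Matrix.mul_adjugate, smul_smul, paramDet]

theorem Law.exists_orbitParam_eq_of_mem_orbit (h : l' ∈ l.orbit) :
    ∃ t : ParamIndex n m → ℂ, paramDet t ≠ 0 ∧ l.orbitParam t = l' := by
  obtain ⟨A₀, B₀, A₁, B₁, h₀, h₁, rfl⟩ := Law.exists_transport_eq_of_mem_orbit h
  have det_ne_zero {d : ℕ} {A B : Matrix (Fin d) (Fin d) ℂ} (h : A * B = 1) : A.det ≠ 0 :=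
    (Matrix.isUnit_det_of_right_inverse h).ne_zero
  have smul_adjugate {d : ℕ} {A B : Matrix (Fin d) (Fin d) ℂ} (h : A * B = 1) :
      A.det⁻¹ • A.adjugate = B := by
    rw [← Matrix.inv_eq_right_inv h, Matrix.inv_def, Ring.inverse_eq_inv']
  have hA₀ := det_ne_zero h₀
  have hA₁ := det_ne_zero h₁
  let t : ParamIndex n m → ℂ
    | .even i j => A₀ i j
    | .odd i j => A₁ i j
    | .scale => (A₀.det * A₁.det)⁻¹
  have ht₀ : evenMatrix t = A₀ := rfl
  have ht₁ : oddMatrix t = A₁ := rfl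
  have hs : t .scale = (A₀.det * A₁.det)⁻¹ := rfl
  refine ⟨t, ?_, ?_⟩
  · rw [paramDet, ht₀, ht₁, hs]
    field_simp
    exact one_ne_zero
  · rw [Law.orbitParam, ht₀, ht₁, hs, ← smul_adjugate h₀, ← smul_adjugate h₁]
    congr 2 <;> field_simp

theorem Law.orbit_eq_image (l : Law n m) : l.orbit = l.orbitParam '' {t | paramDet t ≠ 0} :=
  Set.Subset.antisymm (fun _ h => Law.exists_orbitParam_eq_of_mem_orbit h)
    (Set.image_subset_iff.2 fun _ ht => Law.orbitParam_mem_orbit ht)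

theorem Law.isIrreducible_orbit (l : Law n m) : IsIrreducible l.orbit := by
  refine ⟨⟨l, LinearEquiv.refl _ _, LinearEquiv.refl _ _, fun x y => rfl⟩, ?_⟩
  have h₀ : ∀ i j, (fun t : ParamIndex n m → ℂ => evenMatrix t i j) ∈ polynomialFunctions _ ℂ :=
    fun i j => coord_mem_polynomialFunctions (ParamIndex.even i j)
  have h₁ : ∀ i j, (fun t : ParamIndex n m → ℂ => oddMatrix t i j) ∈ polynomialFunctions _ ℂ :=
    fun i j => coord_mem_polynomialFunctions (ParamIndex.odd i j)
  have hs := coord_mem_polynomialFunctions (R := ℂ) (ParamIndex.scale (n := n) (m := m))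
  rw [l.orbit_eq_image]
  exact isPreirreducible_image_basicOpen
    (l.transport_mem h₀ (fun i j => mul_mem (mul_mem hs (det_mem h₁)) (adjugate_mem h₀ i j))
      h₁ fun i j => mul_mem (mul_mem hs (det_mem h₀)) (adjugate_mem h₁ i j))
    (mul_mem (mul_mem hs (det_mem h₀)) (det_mem h₁))

theorem Law.isIrreducible_orbitInVariety (h : l.orbit ⊆ nilpotentVariety n m) :
    IsIrreducible l.orbitInVariety := by
  have := Subtype.irreducibleSpace l.isIrreducible_orbit
  have h_range : Set.inclusion h '' Set.univ = l.orbitInVariety :=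
    Set.image_univ.trans (Set.range_inclusion h)
  rw [← h_range]
  exact (IrreducibleSpace.isIrreducible_univ _).image _ (continuous_inclusion h).continuousOn

theorem closure_mem_irreducibleComponents_of_isOpen {X : Type*} [TopologicalSpace X] {U : Set X}
    (hU : IsOpen U) (h : IsIrreducible U) : closure U ∈ irreducibleComponents X := by
  refine ⟨h.closure, fun Z hZ hUZ => ?_⟩
  have hUZ' : U ⊆ Z := subset_closure.trans hUZ
  have hne : (Z ∩ U).Nonempty := by
    rw [Set.inter_eq_right.2 hUZ']
    exact h.nonempty
  exact (subset_closure_inter_of_isPreirreducible_of_isOpen hZ.isPreirreducible hU hne).trans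
    (closure_mono Set.inter_subset_right)

end OrbitIrreducible

theorem Law.isLeibniz_iff {n m : ℕ} {l : Law n m} :
    l.IsLeibniz ↔
      (∀ x y z, y.2 = 0 ∨ z.2 = 0 →
        l.bracket x (l.bracket y z) = l.bracket (l.bracket x y) z - l.bracket (l.bracket x z) y) ∧
      ∀ x y z, y.1 = 0 → z.1 = 0 →
        l.bracket x (l.bracket y z) =
          l.bracket (l.bracket x y) z + l.bracket (l.bracket x z) y := by
  have val_zero : (0 : ZMod 2).val = 0 := rfl
  have val_one : (1 : ZMod 2).val = 1 := rfl
  have decompose (x : V n m) : x = (x.1, 0) + (0, x.2) := by simp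
  constructor
  · intro h
    have h₀₀ (x y z : V n m) (hy : y.2 = 0) (hz : z.2 = 0) := by
      simpa [val_zero] using h 0 0 x y z (mem_homogeneous_zero.2 hy) (mem_homogeneous_zero.2 hz)
    have h₀₁ (x y z : V n m) (hy : y.2 = 0) (hz : z.1 = 0) := by
      simpa [val_zero] using h 0 1 x y z (mem_homogeneous_zero.2 hy) (mem_homogeneous_one.2 hz)
    have h₁₀ (x y z : V n m) (hy : y.1 = 0) (hz : z.2 = 0) := by
      simpa [val_zero] using h 1 0 x y z (mem_homogeneous_one.2 hy) (mem_homogeneous_zero.2 hz)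
    refine ⟨?_, fun x y z hy hz => ?_⟩
    · rintro x y z (hy | hz)
      · rw [decompose z]
        simp only [map_add, LinearMap.add_apply, h₀₀ x y (z.1, 0) hy rfl,
          h₀₁ x y (0, z.2) hy rfl]
        abel
      · rw [decompose y]
        simp only [map_add, LinearMap.add_apply, h₀₀ x (y.1, 0) z rfl hz,
          h₁₀ x (0, y.2) z rfl hz]
        abel
    · simpa [val_one] using h 1 1 x y z (mem_homogeneous_one.2 hy) (mem_homogeneous_one.2 hz)
  · rintro ⟨h₀, h₁⟩ α β x y z hy hz
    have eq_zero_or_one : ∀ α : ZMod 2, α = 0 ∨ α = 1 := by decide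
    obtain rfl | rfl := eq_zero_or_one α <;> obtain rfl | rfl := eq_zero_or_one β <;>
      simp only [mem_homogeneous_zero, mem_homogeneous_one] at hy hz
    · simpa [val_zero] using h₀ x y z (.inl hy)
    · simpa [val_zero] using h₀ x y z (.inl hy)
    · simpa [val_zero] using h₀ x y z (.inr hz)
    · simpa [val_one] using h₁ x y z hy hz

section Orbit

variable {n m : ℕ} {l l' : Law n m}

theorem Law.IsLeibniz.of_mem_orbit (hl : l.IsLeibniz) (h : l' ∈ l.orbit) : l'.IsLeibniz := by
  obtain ⟨f₀, f₁, h⟩ := h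
  have apply_bracket (x y : V n m) : (f₀.prodCongr f₁) (l'.bracket x y) =
      l.bracket ((f₀.prodCongr f₁) x) ((f₀.prodCongr f₁) y) := by
    rw [h, LinearEquiv.apply_symm_apply]
  have apply_mem (α : ZMod 2) (x : V n m) (hx : x ∈ homogeneous n m α) :
      (f₀.prodCongr f₁) x ∈ homogeneous n m α := by
    fin_cases α
    · exact mem_homogeneous_zero.2 (by simp [mem_homogeneous_zero.1 hx])
    · exact mem_homogeneous_one.2 (by simp [mem_homogeneous_one.1 hx])
  intro α β x y z hy hz
  apply (f₀.prodCongr f₁).injective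
  simp only [map_sub, map_smul, apply_bracket]
  exact hl α β _ _ _ (apply_mem α y hy) (apply_mem β z hz)

theorem Law.IsNilpotent.of_mem_orbit (hl : l.IsNilpotent) (h : l' ∈ l.orbit) :
    l'.IsNilpotent := by
  obtain ⟨f₀, f₁, h⟩ := h
  have centralSeries_le (k : ℕ) : l'.centralSeries k ≤
      (l.centralSeries k).comap (f₀.prodCongr f₁ : V n m →ₗ[ℂ] V n m) := by
    induction k with
    | zero => exact fun _ _ => Submodule.mem_top
    | succ k ih =>
      refine Submodule.map₂_le.2 fun x hx y _ => ?_
      rw [Submodule.mem_comap, h, LinearEquiv.coe_coe, LinearEquiv.apply_symm_apply]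
      exact Submodule.apply_mem_map₂ _ (ih hx) Submodule.mem_top
  obtain ⟨k, hk⟩ := hl
  refine ⟨k, (Submodule.eq_bot_iff _).2 fun x hx => ?_⟩
  have := centralSeries_le k hx
  rwa [hk, Submodule.mem_comap, Submodule.mem_bot, LinearEquiv.coe_coe,
    LinearEquiv.map_eq_zero_iff] at this

theorem Law.orbit_subset_nilpotentVariety (hl : l ∈ nilpotentVariety n m) :
    l.orbit ⊆ nilpotentVariety n m :=
  fun _ h => ⟨hl.1.of_mem_orbit h, hl.2.of_mem_orbit h⟩

theorem Law.mem_orbit_of_basis (b₀ : Module.Basis (Fin n) ℂ (Fin n → ℂ))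
    (b₁ : Module.Basis (Fin m) ℂ (Fin m → ℂ))
    (h₀₀ : ∀ i j, l'.bracket (b₀ i, 0) (b₀ j, 0) = ∑ k, l (.xx i j k) • (b₀ k, 0))
    (h₀₁ : ∀ i j, l'.bracket (b₀ i, 0) (0, b₁ j) = ∑ k, l (.xy i j k) • (0, b₁ k))
    (h₁₀ : ∀ i j, l'.bracket (0, b₁ i) (b₀ j, 0) = ∑ k, l (.yx i j k) • (0, b₁ k))
    (h₁₁ : ∀ i j, l'.bracket (0, b₁ i) (0, b₁ j) = ∑ k, l (.yy i j k) • (b₀ k, 0)) :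
    l' ∈ l.orbit := by
  let f := b₀.equivFun.prodCongr b₁.equivFun
  have h : l'.bracket = (l.bracket.compl₁₂ f.toLinearMap f.toLinearMap).compr₂
      f.symm.toLinearMap := by
    refine bilinear_ext_basis b₀ b₁ (fun i j => ?_) (fun i j => ?_) (fun i j => ?_)
      (fun i j => ?_)
    · simp [h₀₀, f, Law.bracket_apply, Finsupp.single_apply, b₀.equivFun_symm_apply, Prod.ext_iff,
        Prod.fst_sum, Prod.snd_sum]
    · simp [h₀₁, f, Law.bracket_apply, Finsupp.single_apply, b₁.equivFun_symm_apply, Prod.ext_iff,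
        Prod.fst_sum, Prod.snd_sum]
    · simp [h₁₀, f, Law.bracket_apply, Finsupp.single_apply, b₁.equivFun_symm_apply, Prod.ext_iff,
        Prod.fst_sum, Prod.snd_sum]
    · simp [h₁₁, f, Law.bracket_apply, Finsupp.single_apply, b₀.equivFun_symm_apply, Prod.ext_iff,
        Prod.fst_sum, Prod.snd_sum]
  exact ⟨b₀.equivFun, b₁.equivFun, fun x y => congrArg (fun B => B x y) h⟩

end Orbit

section Nilpotent

variable {n m : ℕ} {l : Law n m}

/-- Right multiplication `R_a = [·, a]`, as a linear function of `a`. -/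
def Law.rightMul (l : Law n m) : V n m →ₗ[ℂ] Module.End ℂ (V n m) :=
  l.bracket.flip

theorem Law.rightMul_apply (a x : V n m) : l.rightMul a x = l.bracket x a :=
  rfl

theorem Law.IsNilpotent.isNilpotent_rightMul (hl : l.IsNilpotent) (a : V n m) :
    _root_.IsNilpotent (l.rightMul a) := by
  obtain ⟨k, hk⟩ := hl
  have pow_apply_mem (k : ℕ) (v : V n m) : (l.rightMul a ^ k) v ∈ l.centralSeries k := by
    induction k with
    | zero => exact Submodule.mem_top
    | succ k ih =>
      rw [pow_succ', Module.End.mul_apply, Law.rightMul_apply, Law.centralSeries]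
      exact Submodule.apply_mem_map₂ l.bracket ih Submodule.mem_top
  refine ⟨k, LinearMap.ext fun v => ?_⟩
  have := pow_apply_mem k v
  rwa [hk, Submodule.mem_bot] at this

/-- The span of the even and odd basis vectors of index at least `d`. -/
def coordFiltration (n m d : ℕ) : Submodule ℂ (V n m) :=
  (Submodule.pi {i : Fin n | (i : ℕ) < d} fun _ => ⊥).prod
    (Submodule.pi {i : Fin m | (i : ℕ) < d} fun _ => ⊥)

theorem mem_coordFiltration {d : ℕ} {x : V n m} :
    x ∈ coordFiltration n m d ↔
      (∀ i : Fin n, (i : ℕ) < d → x.1 i = 0) ∧ ∀ i : Fin m, (i : ℕ) < d → x.2 i = 0 := by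
  simp [coordFiltration, Submodule.mem_pi]

theorem sum_sum_eq_zero_of_index_lt {p q d k : ℕ} {f : Fin p → ℂ} {g : Fin q → ℂ}
    {c : Fin p → Fin q → ℂ} (hf : ∀ i : Fin p, (i : ℕ) < d → f i = 0)
    (hc : ∀ i j, c i j ≠ 0 → (i : ℕ) < k) (hk : k < d + 1) : ∑ i, ∑ j, f i * g j * c i j = 0 := by
  refine Finset.sum_eq_zero fun i _ => Finset.sum_eq_zero fun j _ => ?_
  by_cases h : c i j = 0
  · rw [h, mul_zero]
  · have := hc i j h
    rw [hf i (by omega), zero_mul, zero_mul]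

/-- Right multiplications strictly raise the index of basis vectors. -/
def Law.RaisesIndex (l : Law n m) : Prop :=
  (∀ i j k, l (.xx i j k) ≠ 0 → (i : ℕ) < k) ∧ (∀ i j k, l (.xy i j k) ≠ 0 → (i : ℕ) < k) ∧
    (∀ i j k, l (.yx i j k) ≠ 0 → (i : ℕ) < k) ∧ ∀ i j k, l (.yy i j k) ≠ 0 → (i : ℕ) < k

theorem Law.RaisesIndex.bracket_mem_coordFiltration (hl : l.RaisesIndex) {d : ℕ} {x : V n m}
    (hx : x ∈ coordFiltration n m d) (y : V n m) :
    l.bracket x y ∈ coordFiltration n m (d + 1) := by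
  obtain ⟨hxx, hxy, hyx, hyy⟩ := hl
  obtain ⟨hx₀, hx₁⟩ := mem_coordFiltration.1 hx
  refine mem_coordFiltration.2 ⟨fun k hk => ?_, fun k hk => ?_⟩
  · change _ + _ = (0 : ℂ)
    rw [sum_sum_eq_zero_of_index_lt hx₀ (fun i j => hxx i j k) hk,
      sum_sum_eq_zero_of_index_lt hx₁ (fun i j => hyy i j k) hk, add_zero]
  · change _ + _ = (0 : ℂ)
    rw [sum_sum_eq_zero_of_index_lt hx₀ (fun i j => hxy i j k) hk,
      sum_sum_eq_zero_of_index_lt hx₁ (fun i j => hyx i j k) hk, add_zero]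

theorem Law.RaisesIndex.isNilpotent (hl : l.RaisesIndex) : l.IsNilpotent := by
  have centralSeries_le (d : ℕ) : l.centralSeries d ≤ coordFiltration n m d := by
    induction d with
    | zero => exact fun x _ => mem_coordFiltration.2 ⟨fun _ h => absurd h (Nat.not_lt_zero _),
        fun _ h => absurd h (Nat.not_lt_zero _)⟩
    | succ d ih =>
      exact Submodule.map₂_le.2 fun x hx y _ => hl.bracket_mem_coordFiltration (ih hx) y
  refine ⟨n + m, (Submodule.eq_bot_iff _).2 fun x hx => ?_⟩
  obtain ⟨hx₀, hx₁⟩ := mem_coordFiltration.1 (centralSeries_le _ hx)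
  exact Prod.ext (funext fun i => hx₀ i (by omega)) (funext fun i => hx₁ i (by omega))

end Nilpotent

section ModelLaw

/-- The even basis vector `X_k`, which is zero for `k > n`. -/
def unitVec (n k : ℕ) : Fin (n + 1) → ℂ := fun i => if (i : ℕ) = k then 1 else 0

/-- The nilpotent shift `X_i ↦ X_{i+1}` of `V₀`. -/
def shift (n : ℕ) : (Fin (n + 1) → ℂ) →ₗ[ℂ] (Fin (n + 1) → ℂ) where
  toFun v := ∑ i : Fin (n + 1), v i • unitVec n (i + 1)
  map_add' v w := by simp [add_smul, Finset.sum_add_distrib]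
  map_smul' c v := by simp [Finset.smul_sum, mul_smul]

/-- The family containing `μ₂` (for `b = 0`) and `μ₃` (for `b = -1`): with `x = X_0`, `y = Y_1`
and `z = Y_2` the products are `[X_i, x] = X_{i+1}`, `[y, x] = z`, `[x, y] = b z`,
`[y, y] = X_{n-1}`, `[y, z] = -b X_n` and `[z, y] = (b + 1) X_n`. -/
def modelLaw (n : ℕ) (b : ℂ) : Law (n + 1) 2
  | .xx i j k => if j = 0 ∧ (k : ℕ) = i + 1 then 1 else 0
  | .xy i j k => if i = 0 ∧ j = 0 ∧ k = 1 then b else 0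
  | .yx i j k => if i = 0 ∧ j = 0 ∧ k = 1 then 1 else 0
  | .yy i j k =>
      if i = 0 ∧ j = 0 ∧ (k : ℕ) + 1 = n then 1
      else if i = 0 ∧ j = 1 ∧ (k : ℕ) = n then -b
      else if i = 1 ∧ j = 0 ∧ (k : ℕ) = n then b + 1 else 0

theorem mu2_eq_modelLaw (n : ℕ) : mu2 n = modelLaw n 0 := by
  funext s
  rcases s with _ | _ | _ | ⟨i, j, k⟩
  · rfl
  · simp [mu2, modelLaw]
  · rfl
  · fin_cases i <;> fin_cases j <;> simp [mu2, modelLaw]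

theorem mu3_eq_modelLaw (n : ℕ) : mu3 n = modelLaw n (-1) := by
  funext s
  rcases s with _ | _ | _ | ⟨i, j, k⟩
  · rfl
  · rfl
  · rfl
  · fin_cases i <;> fin_cases j <;> simp [mu3, modelLaw]

variable {n : ℕ} {b : ℂ}

theorem unitVec_eq_zero {k : ℕ} (hk : n < k) : unitVec n k = 0 :=
  funext fun i => if_neg (by omega)

theorem unitVec_apply_zero {k : ℕ} (hk : k ≠ 0) : unitVec n k 0 = 0 :=
  if_neg (by simpa using hk.symm)

theorem shift_apply (v : Fin (n + 1) → ℂ) (k : Fin (n + 1)) :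
    shift n v k = ∑ i : Fin (n + 1), if (k : ℕ) = i + 1 then v i else 0 := by
  change (∑ i : Fin (n + 1), v i • unitVec n (i + 1)) k = _
  simp [unitVec]

theorem shift_apply_zero (v : Fin (n + 1) → ℂ) : shift n v 0 = 0 := by
  simp [shift_apply]

theorem shift_unitVec (k : ℕ) : shift n (unitVec n k) = unitVec n (k + 1) := by
  ext j
  rw [shift_apply, unitVec]
  split_ifs with hj
  · rw [Finset.sum_eq_single_of_mem (⟨k, by omega⟩ : Fin (n + 1)) (Finset.mem_univ _)]
    · simp [unitVec, hj]
    · intro i _ hi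
      rw [if_neg fun h => hi (Fin.ext (by simpa using h.symm.trans hj))]
  · refine Finset.sum_eq_zero fun i _ => ?_
    simp only [unitVec]
    grind

theorem modelLaw_bracket (hn : n ≠ 0) (x y : V (n + 1) 2) :
    (modelLaw n b).bracket x y =
      (y.1 0 • shift n x.1 + (x.2 0 * y.2 0) • unitVec n (n - 1) +
          ((b + 1) * (x.2 1 * y.2 0) - b * (x.2 0 * y.2 1)) • unitVec n n,
        ![0, x.2 0 * y.1 0 + b * (x.1 0 * y.2 0)]) := by
  refine Prod.ext (funext fun k => ?_) (funext fun k => ?_)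
  · have hk : ((k : ℕ) + 1 = n) = ((k : ℕ) = n - 1) := propext (by omega)
    have hxx : (∑ i, ∑ j, x.1 i * y.1 j * modelLaw n b (.xx i j k)) = y.1 0 * shift n x.1 k := by
      simp [modelLaw, ite_and, shift_apply, Finset.mul_sum, mul_comm]
    refine (congrArg₂ (· + ·) hxx rfl).trans ?_
    simp only [modelLaw, Fin.isValue, hk, mul_ite, mul_one, mul_neg, mul_zero, Fin.sum_univ_two,
      true_and, zero_ne_one, false_and, and_false, ↓reduceIte, one_ne_zero, add_zero, Pi.add_apply,
      Pi.smul_apply, smul_eq_mul, unitVec]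
    split_ifs <;> ring
  · fin_cases k <;>
      simp [Law.bracket_apply, modelLaw, Fin.sum_univ_two, ite_and, add_comm, mul_comm]

theorem modelLaw_isNilpotent (hn : 2 ≤ n) : (modelLaw n b).IsNilpotent := by
  refine Law.RaisesIndex.isNilpotent ⟨?_, ?_, ?_, ?_⟩ <;> intro i j k h <;>
    simp only [modelLaw] at h <;> grind

theorem modelLaw_isLeibniz (hn : 2 ≤ n) (hb : b = 0 ∨ b = -1) : (modelLaw n b).IsLeibniz := by
  have shift_pred : shift n (unitVec n (n - 1)) = unitVec n n := by
    rw [shift_unitVec, Nat.sub_add_cancel (by omega)]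
  have shift_last : shift n (unitVec n n) = 0 := by
    rw [shift_unitVec, unitVec_eq_zero (by omega)]
  have pred_zero : unitVec n (n - 1) 0 = 0 := unitVec_apply_zero (by omega)
  have last_zero : unitVec n n 0 = 0 := unitVec_apply_zero (by omega)
  refine Law.isLeibniz_iff.2 ⟨?_, fun x y z hy hz => ?_⟩
  · rintro x y z (hy | hz) <;> obtain rfl | rfl := hb <;>
      simp [modelLaw_bracket (show n ≠ 0 by omega), *, shift_apply_zero] <;> module
  · obtain rfl | rfl := hb <;> simp [modelLaw_bracket (show n ≠ 0 by omega), *]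

theorem modelLaw_mem_nilpotentVariety (hn : 2 ≤ n) (hb : b = 0 ∨ b = -1) :
    modelLaw n b ∈ nilpotentVariety (n + 1) 2 :=
  ⟨modelLaw_isLeibniz hn hb, modelLaw_isNilpotent hn⟩

theorem mu2_mem_nilpotentVariety (hn : 2 ≤ n) : mu2 n ∈ nilpotentVariety (n + 1) 2 :=
  mu2_eq_modelLaw n ▸ modelLaw_mem_nilpotentVariety hn (.inl rfl)

theorem mu3_mem_nilpotentVariety (hn : 2 ≤ n) : mu3 n ∈ nilpotentVariety (n + 1) 2 :=
  mu3_eq_modelLaw n ▸ modelLaw_mem_nilpotentVariety hn (.inr rfl)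

end ModelLaw

section NilpotentEnd

variable {K M W : Type*} [Field K] [AddCommGroup M] [Module K M] [AddCommGroup W] [Module K W]
  {T : Module.End K M} {v : M} {d : ℕ}

theorem linearIndependent_pow_apply (hT : IsNilpotent T) (hv : (T ^ d) v ≠ 0) :
    LinearIndependent K fun k : Fin (d + 1) => (T ^ (k : ℕ)) v := by
  induction d generalizing v with
  | zero => exact LinearIndependent.of_subsingleton (ι := Fin 1) 0 hv
  | succ d ih =>
    have hTv : (T ^ d) (T v) ≠ 0 := by rwa [← Module.End.mul_apply, ← pow_succ]
    obtain ⟨L, hL, hL'⟩ : ∃ L, (T ^ L) v ≠ 0 ∧ (T ^ (L + 1)) v = 0 := by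
      by_contra! h
      have pow_ne_zero (k : ℕ) : (T ^ k) v ≠ 0 :=
        Nat.rec (fun h0 => hv (by rw [show v = 0 from h0, map_zero])) h k
      obtain ⟨k, hk⟩ := hT
      exact pow_ne_zero k (by rw [hk, LinearMap.zero_apply])
    have tail_eq : (Fin.tail fun k : Fin (d + 1 + 1) => (T ^ (k : ℕ)) v) =
        fun k : Fin (d + 1) => (T ^ (k : ℕ)) (T v) := by
      funext k
      rw [Fin.tail, Fin.val_succ, pow_succ, Module.End.mul_apply]
    have tail_le : Submodule.span K (Set.range fun k : Fin (d + 1) => (T ^ (k : ℕ)) (T v)) ≤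
        LinearMap.ker (T ^ L) := by
      rw [Submodule.span_le]
      rintro _ ⟨k, rfl⟩
      rw [SetLike.mem_coe, LinearMap.mem_ker, ← Module.End.mul_apply, ← pow_add, add_comm, pow_add,
        Module.End.mul_apply, ← Module.End.mul_apply _ T, ← pow_succ, hL', map_zero]
    rw [linearIndependent_finSucc, tail_eq]
    exact ⟨ih hTv, fun h => hL (tail_le h)⟩

theorem sum_pow_apply_eq_of_apply_apply_eq_zero (hT : IsNilpotent T) (hv : (T ^ (d + 2)) v ≠ 0)
    (hv' : (T ^ (d + 3)) v = 0) {c : Fin (d + 3) → K}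
    (hc : T (T (∑ k, c k • (T ^ (k : ℕ)) v)) = 0) :
    ∑ k, c k • (T ^ (k : ℕ)) v =
      c (Fin.last (d + 1)).castSucc • (T ^ (d + 1)) v + c (Fin.last _) • (T ^ (d + 2)) v := by
  have apply_apply (k : ℕ) : T (T ((T ^ k) v)) = (T ^ k) ((T ^ 2) v) := by
    rw [← Module.End.mul_apply, ← Module.End.mul_apply, ← Module.End.mul_apply (T ^ k), ← pow_add,
      ← pow_two, ← pow_add, add_comm]
  have hv₂ : (T ^ d) ((T ^ 2) v) ≠ 0 := by rwa [← Module.End.mul_apply, ← pow_add]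
  have hlast : (T ^ (d + 1)) ((T ^ 2) v) = 0 := by rwa [← Module.End.mul_apply, ← pow_add]
  have hlast' : (T ^ (d + 2)) ((T ^ 2) v) = 0 := by
    rw [pow_succ', Module.End.mul_apply, hlast, map_zero]
  have hc₀ : ∀ k : Fin (d + 1), c k.castSucc.castSucc = 0 := by
    refine Fintype.linearIndependent_iff.1 (linearIndependent_pow_apply hT hv₂) _ ?_
    simpa [Fin.sum_univ_castSucc, apply_apply, hlast, hlast'] using hc
  simp [Fin.sum_univ_castSucc (n := d + 2), Fin.sum_univ_castSucc (n := d + 1), hc₀]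

theorem linearIndependent_of_pow_apply_eq (hT : IsNilpotent T) (hv : (T ^ d) v ≠ 0)
    {i : W →ₗ[K] M} {w : ℕ → W} (hw : ∀ k, i (w k) = (T ^ k) v) :
    LinearIndependent K fun k : Fin (d + 1) => w k := by
  refine LinearIndependent.of_comp i ?_
  simpa only [Function.comp_def, hw] using linearIndependent_pow_apply hT hv

theorem pow_apply_eq_zero_of_finrank [FiniteDimensional K W] (hT : IsNilpotent T)
    {i : W →ₗ[K] M} {w : ℕ → W} (hw : ∀ k, i (w k) = (T ^ k) v) :
    (T ^ Module.finrank K W) v = 0 := by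
  by_contra h
  simpa using (linearIndependent_of_pow_apply_eq hT h hw).fintype_card_le_finrank

theorem exists_basis_of_pow_apply_eq (hT : IsNilpotent T) (hv : (T ^ d) v ≠ 0)
    (hd : Module.finrank K W = d + 1) {i : W →ₗ[K] M} {w : ℕ → W} (hw : ∀ k, i (w k) = (T ^ k) v) :
    ∃ b : Module.Basis (Fin (d + 1)) K W, ∀ k, b k = w k :=
  ⟨basisOfLinearIndependentOfCardEqFinrank (linearIndependent_of_pow_apply_eq hT hv hw)
    (by rw [hd, Fintype.card_fin]), fun k => by simp⟩

end NilpotentEnd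

section RightMul

variable {n m : ℕ} {l : Law n m} {a b x y : V n m}

theorem Law.rightMul_snd_of_even_even (ha : a.2 = 0) (hb : b.2 = 0) : (l.rightMul b a).2 = 0 := by
  rw [Law.rightMul_apply, l.bracket_snd_of_even_even ha hb]

theorem Law.rightMul_snd_of_odd_odd (ha : a.1 = 0) (hb : b.1 = 0) : (l.rightMul b a).2 = 0 := by
  rw [Law.rightMul_apply, l.bracket_snd_of_odd_odd ha hb]

theorem Law.rightMul_fst_of_even_odd (ha : a.2 = 0) (hb : b.1 = 0) : (l.rightMul b a).1 = 0 := by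
  rw [Law.rightMul_apply, l.bracket_fst_of_even_odd ha hb]

theorem Law.rightMul_fst_of_odd_even (ha : a.1 = 0) (hb : b.2 = 0) : (l.rightMul b a).1 = 0 := by
  rw [Law.rightMul_apply, l.bracket_fst_of_odd_even ha hb]

theorem Law.rightMul_pow_snd_of_even_even (hx : x.2 = 0) (ha : a.2 = 0) (k : ℕ) :
    ((l.rightMul x ^ k) a).2 = 0 := by
  induction k with
  | zero => exact ha
  | succ k ih =>
    rw [pow_succ', Module.End.mul_apply]
    exact rightMul_snd_of_even_even ih hx

theorem Law.rightMul_pow_fst_of_even_odd (hx : x.2 = 0) (ha : a.1 = 0) (k : ℕ) :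
    ((l.rightMul x ^ k) a).1 = 0 := by
  induction k with
  | zero => exact ha
  | succ k ih =>
    rw [pow_succ', Module.End.mul_apply]
    exact rightMul_fst_of_odd_even ih hx

theorem Law.IsLeibniz.rightMul_rightMul (hl : l.IsLeibniz) (h : a.2 = 0 ∨ b.2 = 0) :
    l.rightMul (l.rightMul b a) = l.rightMul b * l.rightMul a - l.rightMul a * l.rightMul b :=
  LinearMap.ext fun x => (Law.isLeibniz_iff.1 hl).1 x a b h

theorem Law.IsLeibniz.rightMul_rightMul_of_odd (hl : l.IsLeibniz) (ha : a.1 = 0) (hb : b.1 = 0) :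
    l.rightMul (l.rightMul b a) = l.rightMul b * l.rightMul a + l.rightMul a * l.rightMul b :=
  LinearMap.ext fun x => (Law.isLeibniz_iff.1 hl).2 x a b ha hb

end RightMul

section AdaptedPair

variable {n : ℕ} {l : Law (n + 1) 2} {a x y : V (n + 1) 2}

/-- An even `x` and an odd `y` whose left-normed powers `R_x^k x` and `R_x^k y` do not vanish for
`k ≤ n` and `k ≤ 1`. In a nilpotent law they form homogeneous bases. In the names of lemmas `z`
stands for `R_x y = [y, x]`. -/
structure Law.IsAdaptedPair (l : Law (n + 1) 2) (x y : V (n + 1) 2) : Prop where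
  even : x.2 = 0
  odd : y.1 = 0
  pow_ne_zero : (l.rightMul x ^ n) x ≠ 0
  rightMul_ne_zero : l.rightMul x y ≠ 0

namespace Law.IsAdaptedPair

theorem inl_pow (h : l.IsAdaptedPair x y) (k : ℕ) :
    LinearMap.inl ℂ _ _ ((l.rightMul x ^ k) x).1 = (l.rightMul x ^ k) x :=
  Prod.ext rfl (rightMul_pow_snd_of_even_even h.even h.even k).symm

theorem inr_pow (h : l.IsAdaptedPair x y) (k : ℕ) :
    LinearMap.inr ℂ _ _ ((l.rightMul x ^ k) y).2 = (l.rightMul x ^ k) y :=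
  Prod.ext (rightMul_pow_fst_of_even_odd h.even h.odd k).symm rfl

theorem exists_basis_even (h : l.IsAdaptedPair x y) (hl : l.IsNilpotent) :
    ∃ e : Module.Basis (Fin (n + 1)) ℂ (Fin (n + 1) → ℂ),
      ∀ k, (e k, 0) = (l.rightMul x ^ (k : ℕ)) x := by
  obtain ⟨e, he⟩ := exists_basis_of_pow_apply_eq (hl.isNilpotent_rightMul x) h.pow_ne_zero
    (by simp) h.inl_pow
  exact ⟨e, fun k => by rw [he]; exact h.inl_pow k⟩

theorem exists_basis_odd (h : l.IsAdaptedPair x y) (hl : l.IsNilpotent) :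
    ∃ f : Module.Basis (Fin 2) ℂ (Fin 2 → ℂ), (0, f 0) = y ∧ (0, f 1) = l.rightMul x y := by
  obtain ⟨f, hf⟩ := exists_basis_of_pow_apply_eq (d := 1) (hl.isNilpotent_rightMul x)
    (by simpa using h.rightMul_ne_zero) (by simp) h.inr_pow
  refine ⟨f, ?_, ?_⟩
  · rw [hf]; exact h.inr_pow 0
  · rw [hf]; exact h.inr_pow 1

theorem rightMul_pow_succ_eq_zero (h : l.IsAdaptedPair x y) (hl : l.IsNilpotent) :
    (l.rightMul x ^ (n + 1)) x = 0 := by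
  simpa using pow_apply_eq_zero_of_finrank (hl.isNilpotent_rightMul x) h.inl_pow

theorem rightMul_x_z_eq_zero (h : l.IsAdaptedPair x y) (hl : l.IsNilpotent) :
    l.rightMul x (l.rightMul x y) = 0 := by
  simpa [pow_two] using pow_apply_eq_zero_of_finrank (hl.isNilpotent_rightMul x) h.inr_pow

theorem exists_eq_sum_of_even (h : l.IsAdaptedPair x y) (hl : l.IsNilpotent) (ha : a.2 = 0) :
    ∃ c : Fin (n + 1) → ℂ, a = ∑ k, c k • (l.rightMul x ^ (k : ℕ)) x := by
  obtain ⟨e, he⟩ := h.exists_basis_even hl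
  refine ⟨e.repr a.1, ?_⟩
  simp only [← he, Prod.smul_mk, smul_zero, ← prod_mk_sum, Finset.sum_const_zero, e.sum_repr]
  exact Prod.ext rfl ha

theorem exists_eq_smul_add_smul_of_odd (h : l.IsAdaptedPair x y) (hl : l.IsNilpotent)
    (ha : a.1 = 0) : ∃ c d : ℂ, a = c • y + d • l.rightMul x y := by
  obtain ⟨f, hf₀, hf₁⟩ := h.exists_basis_odd hl
  refine ⟨f.repr a.2 0, f.repr a.2 1, ?_⟩
  rw [← hf₁, ← hf₀, Prod.smul_mk, Prod.smul_mk, smul_zero, smul_zero, Prod.mk_add_mk, add_zero,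
    ← Fin.sum_univ_two fun k => f.repr a.2 k • f k, f.sum_repr]
  exact Prod.ext ha rfl

theorem mem_of_even (h : l.IsAdaptedPair x y) (hl : l.IsNilpotent)
    {S : Submodule ℂ (V (n + 1) 2)} (hx : x ∈ S)
    (hS : ∀ b : V (n + 1) 2, b.2 = 0 → b ∈ S → l.rightMul x b ∈ S) (ha : a.2 = 0) : a ∈ S := by
  have pow_mem (k : ℕ) : (l.rightMul x ^ k) x ∈ S := by
    induction k with
    | zero => exact hx
    | succ k ih =>
      rw [pow_succ', Module.End.mul_apply]
      exact hS _ (rightMul_pow_snd_of_even_even h.even h.even k) ih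
  obtain ⟨c, rfl⟩ := h.exists_eq_sum_of_even hl ha
  exact S.sum_mem fun k _ => S.smul_mem _ (pow_mem k)

theorem rightMul_image_eq_zero (h : l.IsAdaptedPair x y) (hl : l ∈ nilpotentVariety (n + 1) 2)
    (ha : a.2 = 0) : l.rightMul (l.rightMul x a) = 0 := by
  refine h.mem_of_even hl.2 (S := LinearMap.ker (l.rightMul ∘ₗ l.rightMul x)) ?_ (fun b _ h0 => ?_)
    ha
  · rw [LinearMap.mem_ker, LinearMap.comp_apply, hl.1.rightMul_rightMul (.inl h.even), sub_self]
  · rw [LinearMap.mem_ker, LinearMap.comp_apply] at h0 ⊢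
    rw [hl.1.rightMul_rightMul (.inr h.even), h0, mul_zero, zero_mul, sub_zero]

theorem exists_rightMul_eq_smul (h : l.IsAdaptedPair x y) (hl : l ∈ nilpotentVariety (n + 1) 2)
    (ha : a.2 = 0) : ∃ c : ℂ, l.rightMul a = c • l.rightMul x := by
  have : l.rightMul a ∈ ℂ ∙ l.rightMul x := by
    refine h.mem_of_even hl.2 (S := (ℂ ∙ l.rightMul x).comap l.rightMul)
      (Submodule.mem_span_singleton_self _) (fun b hb _ => ?_) ha
    rw [Submodule.mem_comap, h.rightMul_image_eq_zero hl hb]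
    exact Submodule.zero_mem _
  obtain ⟨c, hc⟩ := Submodule.mem_span_singleton.1 this
  exact ⟨c, hc.symm⟩

theorem rightMul_z_eq_sub (h : l.IsAdaptedPair x y) (hl : l.IsLeibniz) :
    l.rightMul (l.rightMul x y) = l.rightMul x * l.rightMul y - l.rightMul y * l.rightMul x :=
  hl.rightMul_rightMul (.inr h.even)

theorem rightMul_rightMul_x (h : l.IsAdaptedPair x y) (hl : l.IsLeibniz) :
    l.rightMul (l.rightMul y x) = -l.rightMul (l.rightMul x y) := by
  rw [hl.rightMul_rightMul (.inl h.even), h.rightMul_z_eq_sub hl, neg_sub]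

theorem commute_rightMul_z (h : l.IsAdaptedPair x y) (hl : l ∈ nilpotentVariety (n + 1) 2) :
    Commute (l.rightMul x) (l.rightMul (l.rightMul x y)) := by
  rw [commute_iff_eq, ← sub_eq_zero, ← hl.1.rightMul_rightMul (.inr h.even),
    h.rightMul_x_z_eq_zero hl.2, map_zero]

/-- Here `R_y` is a multiple of `R_{[y, x]}`, hence commutes with `R_x`, so that
`R_{[y, x]} = [R_x, R_y] = 0`. -/
theorem rightMul_eq_zero_of_smul_add_smul (h : l.IsAdaptedPair x y)
    (hl : l ∈ nilpotentVariety (n + 1) 2) {c d : ℂ} (hc : c ≠ 0)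
    (hcd : l.rightMul (c • y + d • l.rightMul x y) = 0) :
    l.rightMul y = 0 ∧ l.rightMul (l.rightMul x y) = 0 := by
  rw [map_add, map_smul, map_smul] at hcd
  have hcomm : Commute (l.rightMul x) (l.rightMul y) := by
    rw [← Commute.smul_right_iff₀ hc, eq_neg_of_add_eq_zero_left hcd]
    exact ((h.commute_rightMul_z hl).smul_right d).neg_right
  have hz : l.rightMul (l.rightMul x y) = 0 := by
    rw [h.rightMul_z_eq_sub hl.1, hcomm.eq, sub_self]
  rw [hz, smul_zero, add_zero] at hcd
  exact ⟨(smul_eq_zero.1 hcd).resolve_left hc, hz⟩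

theorem exists_rightMul_y_x (h : l.IsAdaptedPair x y) (hl : l ∈ nilpotentVariety (n + 1) 2) :
    ∃ b : ℂ, l.rightMul y x = b • l.rightMul x y := by
  obtain ⟨c, b, hcb⟩ := h.exists_eq_smul_add_smul_of_odd hl.2
    (rightMul_fst_of_even_odd h.even h.odd)
  suffices hc : c = 0 from ⟨b, by rw [hcb, hc, zero_smul, zero_add]⟩
  by_contra hc
  have hy : l.rightMul y = 0 := by
    refine (h.rightMul_eq_zero_of_smul_add_smul hl (d := b + 1) hc ?_).1
    rw [add_smul, one_smul, ← add_assoc, ← hcb, map_add, h.rightMul_rightMul_x hl.1,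
      neg_add_cancel]
  rw [hy, LinearMap.zero_apply] at hcb
  have := congrArg (l.rightMul x) hcb
  rw [map_add, map_smul, map_smul, h.rightMul_x_z_eq_zero hl.2, smul_zero, add_zero,
    map_zero] at this
  exact (smul_ne_zero hc h.rightMul_ne_zero) this.symm

theorem rightMul_z_x_eq_zero (h : l.IsAdaptedPair x y) (hl : l ∈ nilpotentVariety (n + 1) 2) :
    l.rightMul (l.rightMul x y) x = 0 := by
  have odd : (l.rightMul x y).1 = 0 := rightMul_fst_of_odd_even h.odd h.even
  obtain ⟨c, d, hcd⟩ := h.exists_eq_smul_add_smul_of_odd hl.2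
    (rightMul_fst_of_even_odd h.even odd)
  have ann : l.rightMul (c • y + d • l.rightMul x y) = 0 := by
    rw [← hcd, hl.1.rightMul_rightMul (.inl h.even), (h.commute_rightMul_z hl).eq, sub_self]
  by_contra hne
  have hz : l.rightMul (l.rightMul x y) ≠ 0 := fun h0 => hne (by rw [h0, LinearMap.zero_apply])
  have hc : c = 0 := by_contra fun hc => hz (h.rightMul_eq_zero_of_smul_add_smul hl hc ann).2
  rw [hc, zero_smul, zero_add, map_smul] at ann
  have hd : d = 0 := (smul_eq_zero.1 ann).resolve_right hz
  exact hne (by rw [hcd, hc, hd, zero_smul, zero_smul, add_zero])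

theorem rightMul_z_eq_zero_of_even (h : l.IsAdaptedPair x y) (hl : l ∈ nilpotentVariety (n + 1) 2)
    (ha : a.2 = 0) : l.rightMul (l.rightMul x y) a = 0 := by
  refine h.mem_of_even hl.2 (S := LinearMap.ker (l.rightMul (l.rightMul x y)))
    (h.rightMul_z_x_eq_zero hl) (fun b _ hb => ?_) ha
  rw [LinearMap.mem_ker] at hb ⊢
  rw [← Module.End.mul_apply, ← (h.commute_rightMul_z hl).eq, Module.End.mul_apply, hb, map_zero]

theorem rightMul_y_rightMul_x (h : l.IsAdaptedPair x y) (hl : l.IsLeibniz) (a : V (n + 1) 2) :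
    l.rightMul y (l.rightMul x a) =
      l.rightMul x (l.rightMul y a) - l.rightMul (l.rightMul x y) a := by
  rw [h.rightMul_z_eq_sub hl]
  exact (sub_sub_cancel _ _).symm

theorem rightMul_y_image_eq_zero (h : l.IsAdaptedPair x y) (hl : l ∈ nilpotentVariety (n + 1) 2)
    (ha : a.2 = 0) : l.rightMul y (l.rightMul x a) = 0 := by
  refine h.mem_of_even hl.2 (S := LinearMap.ker (l.rightMul y ∘ₗ l.rightMul x)) ?_
    (fun b hb h0 => ?_) ha
  · obtain ⟨b, hb⟩ := h.exists_rightMul_y_x hl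
    rw [LinearMap.mem_ker, LinearMap.comp_apply, h.rightMul_y_rightMul_x hl.1, hb, map_smul,
      h.rightMul_x_z_eq_zero hl.2, h.rightMul_z_x_eq_zero hl, smul_zero, sub_zero]
  · rw [LinearMap.mem_ker, LinearMap.comp_apply] at h0 ⊢
    rw [h.rightMul_y_rightMul_x hl.1, h0, map_zero,
      h.rightMul_z_eq_zero_of_even hl (rightMul_snd_of_even_even hb h.even), sub_zero]

/-- `R_{[y, y]} = 2 R_y ^ 2` is a multiple of `R_x` that kills `[x, x]`, whereas
`[[x, x], x] ≠ 0`. -/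
theorem rightMul_y_rightMul_y_eq_zero (h : l.IsAdaptedPair x y)
    (hl : l ∈ nilpotentVariety (n + 1) 2) (hn : 2 ≤ n) (a : V (n + 1) 2) :
    l.rightMul y (l.rightMul y a) = 0 := by
  have hyy : l.rightMul (l.rightMul y y) = (2 : ℂ) • (l.rightMul y * l.rightMul y) := by
    rw [hl.1.rightMul_rightMul_of_odd h.odd h.odd, two_smul]
  obtain ⟨c, hc⟩ := h.exists_rightMul_eq_smul hl (rightMul_snd_of_odd_odd h.odd h.odd)
  have xxx_ne_zero : l.rightMul x (l.rightMul x x) ≠ 0 := by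
    intro h0
    refine h.pow_ne_zero ?_
    rw [← pow_sub_mul_pow _ hn, Module.End.mul_apply, pow_two, Module.End.mul_apply, h0, map_zero]
  have hc0 : c = 0 := by
    have := LinearMap.congr_fun (hc.symm.trans hyy) (l.rightMul x x)
    rw [LinearMap.smul_apply, LinearMap.smul_apply, Module.End.mul_apply,
      h.rightMul_y_image_eq_zero hl h.even, map_zero, smul_zero] at this
    exact (smul_eq_zero.1 this).resolve_right xxx_ne_zero
  rw [hc0, zero_smul, hyy] at hc
  exact LinearMap.congr_fun ((smul_eq_zero.1 hc).resolve_left two_ne_zero) a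

theorem rightMul_y_z_add_rightMul_z_y (h : l.IsAdaptedPair x y) (hl : l.IsLeibniz) :
    l.rightMul y (l.rightMul x y) + l.rightMul (l.rightMul x y) y =
      l.rightMul x (l.rightMul y y) := by
  rw [h.rightMul_y_rightMul_x hl, sub_add_cancel]

theorem rightMul_z_z_eq (h : l.IsAdaptedPair x y) (hl : l ∈ nilpotentVariety (n + 1) 2) :
    l.rightMul (l.rightMul x y) (l.rightMul x y) =
      l.rightMul x (l.rightMul y (l.rightMul x y)) := by
  rw [eq_comm, ← sub_eq_zero, ← h.rightMul_y_rightMul_x hl.1, h.rightMul_x_z_eq_zero hl.2, map_zero]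

end Law.IsAdaptedPair

end AdaptedPair

section Recognition

variable {n : ℕ} {l : Law (n + 1) 2} {x y : V (n + 1) 2} {b : ℂ}

/-- An adapted pair that multiplies like the pair `X_0`, `Y_1` of the law `modelLaw n b`, except
that `[y, y]` need not be `R_x^(n-1) x`. -/
structure Law.IsModelPair (l : Law (n + 1) 2) (x y : V (n + 1) 2) (b : ℂ) : Prop
    extends l.IsAdaptedPair x y where
  rightMul_y_x : l.rightMul y x = b • l.rightMul x y
  rightMul_y_z : l.rightMul y (l.rightMul x y) = (b + 1) • l.rightMul x (l.rightMul y y)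
  rightMul_z_y : l.rightMul (l.rightMul x y) y = -b • l.rightMul x (l.rightMul y y)
  rightMul_z_z : l.rightMul (l.rightMul x y) (l.rightMul x y) = 0
  rightMul_x_rightMul_y_y_ne_zero : l.rightMul x (l.rightMul y y) ≠ 0

theorem Law.IsAdaptedPair.isModelPair_zero (h : l.IsAdaptedPair x y)
    (hl : l ∈ nilpotentVariety (n + 1) 2) (hn : 2 ≤ n)
    (hne : l.rightMul y (l.rightMul x y) ≠ 0) : l.IsModelPair x y 0 := by
  obtain ⟨b, hb⟩ := h.exists_rightMul_y_x hl
  have hb0 : b = 0 := by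
    have := h.rightMul_y_rightMul_y_eq_zero hl hn x
    rw [hb, map_smul] at this
    exact (smul_eq_zero.1 this).resolve_right hne
  have hyx : l.rightMul y x = 0 := by rw [hb, hb0, zero_smul]
  have hz : l.rightMul (l.rightMul x y) = 0 := by
    rw [← neg_eq_zero, ← h.rightMul_rightMul_x hl.1, hyx, map_zero]
  have hzy : l.rightMul y (l.rightMul x y) = l.rightMul x (l.rightMul y y) := by
    simpa [hz] using h.rightMul_y_z_add_rightMul_z_y hl.1
  exact ⟨h, by simp [hyx], by simp [hzy], by simp [hz], by simp [hz], hzy ▸ hne⟩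

theorem Law.IsAdaptedPair.isModelPair_neg_one (h : l.IsAdaptedPair x y)
    (hl : l ∈ nilpotentVariety (n + 1) 2) (hn : 2 ≤ n)
    (hne : l.rightMul (l.rightMul x y) y ≠ 0) : l.IsModelPair x y (-1) := by
  obtain ⟨b, hb⟩ := h.exists_rightMul_y_x hl
  have hb1 : b = -1 := by
    have hz : (b + 1) • l.rightMul (l.rightMul x y) = 0 := by
      rw [add_smul, one_smul, ← map_smul, ← hb, h.rightMul_rightMul_x hl.1, neg_add_cancel]
    refine eq_neg_of_add_eq_zero_left ((smul_eq_zero.1 hz).resolve_right fun h0 => hne ?_)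
    rw [h0, LinearMap.zero_apply]
  rw [hb1] at hb
  have hzy : l.rightMul y (l.rightMul x y) = 0 := by
    simpa [hb] using h.rightMul_y_rightMul_y_eq_zero hl hn x
  have hyz : l.rightMul (l.rightMul x y) y = l.rightMul x (l.rightMul y y) := by
    simpa [hzy] using h.rightMul_y_z_add_rightMul_z_y hl.1
  exact ⟨h, hb, by simp [hzy], by simp [hyz], by rw [h.rightMul_z_z_eq hl, hzy, map_zero],
    hyz ▸ hne⟩

namespace Law.IsModelPair

theorem rightMul_x_rightMul_x_rightMul_y_y_eq_zero (h : l.IsModelPair x y b)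
    (hl : l ∈ nilpotentVariety (n + 1) 2) :
    l.rightMul x (l.rightMul x (l.rightMul y y)) = 0 := by
  have hzy : l.rightMul x (l.rightMul (l.rightMul x y) y) = 0 := by
    rw [← Module.End.mul_apply, (h.commute_rightMul_z hl).eq, Module.End.mul_apply, h.rightMul_z_z]
  have hyz : l.rightMul x (l.rightMul y (l.rightMul x y)) = 0 := by
    rw [← h.rightMul_z_z_eq hl, h.rightMul_z_z]
  rw [← h.rightMul_y_z_add_rightMul_z_y hl.1, map_add, hyz, hzy, add_zero]

theorem exists_rightMul_y_y (h : l.IsModelPair x y b) (hl : l ∈ nilpotentVariety (n + 1) 2)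
    (hn : 2 ≤ n) : ∃ s t : ℂ, s ≠ 0 ∧
      l.rightMul y y = s • (l.rightMul x ^ (n - 1)) x + t • (l.rightMul x ^ n) x := by
  obtain ⟨d, rfl⟩ := Nat.exists_eq_add_of_le' hn
  obtain ⟨c, hc⟩ := h.exists_eq_sum_of_even hl.2 (rightMul_snd_of_odd_odd h.odd h.odd)
  have eq_zero := h.rightMul_x_rightMul_x_rightMul_y_y_eq_zero hl
  rw [hc] at eq_zero
  rw [sum_pow_apply_eq_of_apply_apply_eq_zero (hl.2.isNilpotent_rightMul x) h.pow_ne_zero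
    (h.rightMul_pow_succ_eq_zero hl.2) eq_zero] at hc
  refine ⟨_, _, fun h0 => h.rightMul_x_rightMul_y_y_ne_zero ?_, hc⟩
  rw [hc, h0, zero_smul, zero_add, map_smul, ← Module.End.mul_apply, ← pow_succ',
    h.rightMul_pow_succ_eq_zero hl.2, smul_zero]

theorem rightMul_smul_add_smul (h : l.IsModelPair x y b) (hl : l ∈ nilpotentVariety (n + 1) 2)
    (s t : ℂ) : l.rightMul (s • x + t • l.rightMul x x) = s • l.rightMul x := by
  rw [map_add, map_smul, map_smul, h.rightMul_image_eq_zero hl h.even, smul_zero, add_zero]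

theorem rescale (h : l.IsModelPair x y b) (hl : l ∈ nilpotentVariety (n + 1) 2) {r s : ℂ} (t : ℂ)
    (hr : r ≠ 0) (hs : s ≠ 0) : l.IsModelPair (s • x + t • l.rightMul x x) (r • y) b := by
  have hR := h.rightMul_smul_add_smul hl s t
  refine ⟨⟨?_, ?_, ?_, ?_⟩, ?_, ?_, ?_, ?_, ?_⟩
  · simp [h.even, rightMul_snd_of_even_even h.even h.even]
  · simp [h.odd]
  · rw [hR, smul_pow, LinearMap.smul_apply, map_add, map_smul, map_smul, ← Module.End.mul_apply,
      ← pow_succ, h.rightMul_pow_succ_eq_zero hl.2, smul_zero, add_zero]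
    exact smul_ne_zero (pow_ne_zero _ hs) (smul_ne_zero hs h.pow_ne_zero)
  · simpa [hR, hr, hs] using h.rightMul_ne_zero
  · simp only [map_smul, LinearMap.smul_apply, map_add, h.rightMul_y_x,
      h.rightMul_y_image_eq_zero hl h.even, smul_zero, add_zero, hR]
    module
  · simp only [map_smul, hR, LinearMap.smul_apply, h.rightMul_y_z]
    module
  · simp only [hR, map_smul, LinearMap.smul_apply, h.rightMul_z_y]
    module
  · simp [hR, h.rightMul_z_z]
  · simpa [hR, hr, hs] using h.rightMul_x_rightMul_y_y_ne_zero

theorem exists_normalized (h : l.IsModelPair x y b) (hl : l ∈ nilpotentVariety (n + 1) 2)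
    (hn : 2 ≤ n) :
    ∃ x' y', l.IsModelPair x' y' b ∧ l.rightMul y' y' = (l.rightMul x' ^ (n - 1)) x' := by
  obtain ⟨s, t, hs, hyy⟩ := h.exists_rightMul_y_y hl hn
  obtain ⟨r, hr⟩ := IsAlgClosed.exists_eq_mul_self (s ^ (n - 1))
  have hr0 : r ≠ 0 := by
    rintro rfl
    exact pow_ne_zero _ hs (hr.trans (mul_zero 0))
  refine ⟨_, _, h.rescale hl t hr0 hs, ?_⟩
  calc l.rightMul (r • y) (r • y) = (r * r) • l.rightMul y y := by
        rw [map_smul, map_smul, LinearMap.smul_apply, smul_smul]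
    _ = s ^ (n - 1) • (l.rightMul x ^ (n - 1)) (s • x + t • l.rightMul x x) := by
        rw [← hr, hyy, map_add, map_smul, map_smul, ← Module.End.mul_apply, ← pow_succ,
          Nat.sub_add_cancel (by omega)]
    _ = _ := by rw [h.rightMul_smul_add_smul hl, smul_pow, LinearMap.smul_apply]

end Law.IsModelPair

theorem Law.IsAdaptedPair.sum_ite_smul_pow (h : l.IsAdaptedPair x y) (hl : l.IsNilpotent) (m : ℕ)
    (c : ℂ) : ∑ k : Fin (n + 1), (if (k : ℕ) = m then c else 0) • (l.rightMul x ^ (k : ℕ)) x =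
      c • (l.rightMul x ^ m) x := by
  rw [Fin.sum_univ_eq_sum_range fun k => (if k = m then c else 0) • (l.rightMul x ^ k) x]
  by_cases hm : m < n + 1
  · simp [ite_smul, Finset.sum_ite_eq', hm]
  · rw [← Nat.sub_add_cancel (not_lt.1 hm), pow_add, Module.End.mul_apply,
      h.rightMul_pow_succ_eq_zero hl, map_zero, smul_zero, Nat.sub_add_cancel (not_lt.1 hm)]
    refine Finset.sum_eq_zero fun k hk => ?_
    rw [if_neg (by have := Finset.mem_range.1 hk; omega), zero_smul]

theorem Law.IsModelPair.mem_orbit_modelLaw (h : l.IsModelPair x y b)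
    (hl : l ∈ nilpotentVariety (n + 1) 2) (hn : 2 ≤ n)
    (hyy : l.rightMul y y = (l.rightMul x ^ (n - 1)) x) : l ∈ (modelLaw n b).orbit := by
  obtain ⟨e, he⟩ := h.exists_basis_even hl.2
  obtain ⟨f, hf₀, hf₁⟩ := h.exists_basis_odd hl.2
  have he₀ : (e 0, 0) = x := he 0
  have he_succ (i : Fin n) : (e i.succ, 0) = l.rightMul x ((l.rightMul x ^ (i : ℕ)) x) := by
    rw [he, Fin.val_succ, pow_succ', Module.End.mul_apply]
  have even_pow := rightMul_pow_snd_of_even_even (l := l) h.even h.even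
  have pow_last : l.rightMul x ((l.rightMul x ^ (n - 1)) x) = (l.rightMul x ^ n) x := by
    rw [← Module.End.mul_apply, ← pow_succ', Nat.sub_add_cancel (by omega)]
  have hk (k : Fin (n + 1)) : ((k : ℕ) + 1 = n) = ((k : ℕ) = n - 1) := propext (by omega)
  refine Law.mem_orbit_of_basis e f (fun i j => ?_) (fun i j => ?_) (fun i j => ?_)
    (fun i j => ?_) <;> rw [← Law.rightMul_apply]
  · cases j using Fin.cases with
    | zero => simp [-ite_smul, modelLaw, he₀, he, h.sum_ite_smul_pow hl.2, pow_succ']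
    | succ j => simp [modelLaw, he_succ, h.rightMul_image_eq_zero hl (even_pow _)]
  · cases i using Fin.cases with
    | zero =>
      fin_cases j <;>
        simp [-Prod.smul_mk, modelLaw, he₀, hf₀, hf₁, h.rightMul_y_x, h.rightMul_z_x_eq_zero hl]
    | succ i =>
      fin_cases j <;>
        simp [modelLaw, he_succ, hf₀, hf₁, h.rightMul_y_image_eq_zero hl (even_pow _),
          h.rightMul_z_eq_zero_of_even hl (rightMul_snd_of_even_even (even_pow _) h.even)]
  · cases j using Fin.cases with
    | zero => fin_cases i <;> simp [modelLaw, he₀, hf₀, hf₁, h.rightMul_x_z_eq_zero hl.2]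
    | succ j => simp [modelLaw, he_succ, h.rightMul_image_eq_zero hl (even_pow _)]
  · fin_cases i <;> fin_cases j <;>
      simp [-ite_smul, modelLaw, hf₀, hf₁, he, hk, h.sum_ite_smul_pow hl.2, h.rightMul_y_z,
        h.rightMul_z_y, h.rightMul_z_z, pow_last, hyy]

end Recognition

section AdaptedPairModelLaw

variable {n k : ℕ} {b : ℂ}

theorem modelLaw_rightMul_pow (hn : n ≠ 0) (k : ℕ) :
    ((modelLaw n b).rightMul (unitVec n 0, 0) ^ k) (unitVec n 0, 0) = (unitVec n k, 0) := by
  induction k with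
  | zero => rfl
  | succ k ih =>
    rw [pow_succ', Module.End.mul_apply, ih, Law.rightMul_apply, modelLaw_bracket hn]
    simp [shift_unitVec, unitVec]

theorem unitVec_ne_zero (hk : k ≤ n) : unitVec n k ≠ 0 :=
  fun h => by simpa [unitVec] using congrFun h ⟨k, by omega⟩

theorem modelLaw_rightMul_odd (hn : n ≠ 0) :
    (modelLaw n b).rightMul (unitVec n 0, 0) (0, ![1, 0]) = (0, ![0, 1]) := by
  rw [Law.rightMul_apply, modelLaw_bracket hn]
  simp [unitVec]

theorem isAdaptedPair_modelLaw (hn : n ≠ 0) :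
    (modelLaw n b).IsAdaptedPair (unitVec n 0, 0) (0, ![1, 0]) where
  even := rfl
  odd := rfl
  pow_ne_zero := by
    rw [modelLaw_rightMul_pow hn]
    exact fun h => unitVec_ne_zero le_rfl (Prod.mk.inj h).1
  rightMul_ne_zero := by simp [modelLaw_rightMul_odd hn]

theorem modelLaw_rightMul_y_z (hn : n ≠ 0) :
    (modelLaw n b).rightMul (0, ![1, 0])
      ((modelLaw n b).rightMul (unitVec n 0, 0) (0, ![1, 0])) = ((b + 1) • unitVec n n, 0) := by
  rw [modelLaw_rightMul_odd hn, Law.rightMul_apply, modelLaw_bracket hn]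
  simp

theorem modelLaw_rightMul_z_y (hn : n ≠ 0) :
    (modelLaw n b).rightMul ((modelLaw n b).rightMul (unitVec n 0, 0) (0, ![1, 0])) (0, ![1, 0]) =
      (-b • unitVec n n, 0) := by
  rw [modelLaw_rightMul_odd hn, Law.rightMul_apply, modelLaw_bracket hn]
  simp

end AdaptedPairModelLaw

section OrbitCharacterization

theorem Law.exists_equiv_of_mem_orbit {n m : ℕ} {l l' : Law n m} (h : l' ∈ l.orbit) :
    ∃ f : V n m ≃ₗ[ℂ] V n m, (∀ v, v.1 = 0 → (f v).1 = 0) ∧ (∀ v, v.2 = 0 → (f v).2 = 0) ∧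
      ∀ a v, l'.rightMul (f a) (f v) = f (l.rightMul a v) := by
  obtain ⟨f₀, f₁, h⟩ := h
  refine ⟨(f₀.prodCongr f₁).symm, fun v hv => ?_, fun v hv => ?_, fun a v => ?_⟩
  · simp [hv]
  · simp [hv]
  · rw [Law.rightMul_apply, h, LinearEquiv.apply_symm_apply, LinearEquiv.apply_symm_apply,
      Law.rightMul_apply]

variable {n : ℕ} {l l' : Law (n + 1) 2} {x y : V (n + 1) 2}

theorem Law.IsAdaptedPair.map (h : l.IsAdaptedPair x y) {f : V (n + 1) 2 ≃ₗ[ℂ] V (n + 1) 2}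
    (hf₁ : ∀ v, v.1 = 0 → (f v).1 = 0) (hf₂ : ∀ v, v.2 = 0 → (f v).2 = 0)
    (hf : ∀ a v, l'.rightMul (f a) (f v) = f (l.rightMul a v)) :
    l'.IsAdaptedPair (f x) (f y) where
  even := hf₂ x h.even
  odd := hf₁ y h.odd
  pow_ne_zero := by
    have pow_apply (k : ℕ) : (l'.rightMul (f x) ^ k) (f x) = f ((l.rightMul x ^ k) x) := by
      induction k with
      | zero => rfl
      | succ k ih => rw [pow_succ', pow_succ', Module.End.mul_apply, ih, hf, Module.End.mul_apply]
    rw [pow_apply, map_ne_zero_iff f f.injective]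
    exact h.pow_ne_zero
  rightMul_ne_zero := by
    rw [hf, map_ne_zero_iff f f.injective]
    exact h.rightMul_ne_zero

theorem mem_orbit_mu2_iff (hl : l ∈ nilpotentVariety (n + 1) 2) (hn : 2 ≤ n) :
    l ∈ (mu2 n).orbit ↔
      ∃ x y, l.IsAdaptedPair x y ∧ l.rightMul y (l.rightMul x y) ≠ 0 := by
  rw [mu2_eq_modelLaw]
  constructor
  · intro h
    obtain ⟨f, hf₁, hf₂, hf⟩ := Law.exists_equiv_of_mem_orbit h
    refine ⟨_, _, (isAdaptedPair_modelLaw (by omega)).map hf₁ hf₂ hf, ?_⟩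
    rw [hf, hf, modelLaw_rightMul_y_z (by omega)]
    simp [unitVec_ne_zero]
  · rintro ⟨x, y, h, hne⟩
    obtain ⟨x', y', h', hyy⟩ := (h.isModelPair_zero hl hn hne).exists_normalized hl hn
    exact h'.mem_orbit_modelLaw hl hn hyy

theorem mem_orbit_mu3_iff (hl : l ∈ nilpotentVariety (n + 1) 2) (hn : 2 ≤ n) :
    l ∈ (mu3 n).orbit ↔
      ∃ x y, l.IsAdaptedPair x y ∧ l.rightMul (l.rightMul x y) y ≠ 0 := by
  rw [mu3_eq_modelLaw]
  constructor
  · intro h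
    obtain ⟨f, hf₁, hf₂, hf⟩ := Law.exists_equiv_of_mem_orbit h
    refine ⟨_, _, (isAdaptedPair_modelLaw (by omega)).map hf₁ hf₂ hf, ?_⟩
    rw [hf, hf, modelLaw_rightMul_z_y (by omega)]
    simp [unitVec_ne_zero]
  · rintro ⟨x, y, h, hne⟩
    obtain ⟨x', y', h', hyy⟩ := (h.isModelPair_neg_one hl hn hne).exists_normalized hl hn
    exact h'.mem_orbit_modelLaw hl hn hyy

end OrbitCharacterization

section Rigidity

theorem HasCoordinatesIn.rightMul {n m : ℕ} {F G : Law n m → V n m}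
    (hF : HasCoordinatesIn (polynomialFunctions (StructIndex n m) ℂ) F)
    (hG : HasCoordinatesIn (polynomialFunctions (StructIndex n m) ℂ) G) :
    HasCoordinatesIn (polynomialFunctions (StructIndex n m) ℂ)
      fun l : Law n m => l.rightMul (F l) (G l) := by
  have coord_mem (s : StructIndex n m) := coord_mem_polynomialFunctions (R := ℂ) s
  simp only [Law.rightMul_apply]
  exact hG.bracket coord_mem hF

theorem HasCoordinatesIn.rightMul_pow {n m : ℕ} (x v : V n m) (k : ℕ) :
    HasCoordinatesIn (polynomialFunctions (StructIndex n m) ℂ)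
      fun l : Law n m => (l.rightMul x ^ k) v := by
  induction k with
  | zero => exact .const _ v
  | succ k ih =>
    simp only [pow_succ', Module.End.mul_apply]
    exact (HasCoordinatesIn.const _ x).rightMul ih

variable {n : ℕ}

theorem isOpen_setOf_isAdaptedPair (x y : V (n + 1) 2) :
    IsOpen {l : Law (n + 1) 2 | l.IsAdaptedPair x y} := by
  have h : {l : Law (n + 1) 2 | l.IsAdaptedPair x y} =
      {_l | x.2 = 0 ∧ y.1 = 0} ∩ {l | (l.rightMul x ^ n) x ≠ 0} ∩ {l | l.rightMul x y ≠ 0} :=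
    Set.ext fun _ => ⟨fun h => ⟨⟨⟨h.even, h.odd⟩, h.pow_ne_zero⟩, h.rightMul_ne_zero⟩,
      fun ⟨⟨⟨hx, hy⟩, hpow⟩, hne⟩ => ⟨hx, hy, hpow, hne⟩⟩
  rw [h]
  exact (isOpen_const.inter (HasCoordinatesIn.rightMul_pow x x n).isOpen_ne_zero).inter
    ((HasCoordinatesIn.const _ x).rightMul (.const _ y)).isOpen_ne_zero

theorem isOpen_setOf_exists_isAdaptedPair {P : V (n + 1) 2 → V (n + 1) 2 →
    Law (n + 1) 2 → V (n + 1) 2}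
    (hP : ∀ x y, HasCoordinatesIn (polynomialFunctions _ ℂ) (P x y)) :
    IsOpen {l : Law (n + 1) 2 | ∃ x y, l.IsAdaptedPair x y ∧ P x y l ≠ 0} := by
  simp only [Set.ofPred_exists]
  exact isOpen_iUnion fun x => isOpen_iUnion fun y =>
    (isOpen_setOf_isAdaptedPair x y).inter (hP x y).isOpen_ne_zero

theorem isOpen_orbitInVariety_mu2 (hn : 2 ≤ n) : IsOpen (mu2 n).orbitInVariety := by
  have h : (mu2 n).orbitInVariety = Subtype.val ⁻¹'
      {l | ∃ x y, l.IsAdaptedPair x y ∧ l.rightMul y (l.rightMul x y) ≠ 0} :=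
    Set.ext fun l => mem_orbit_mu2_iff l.2 hn
  rw [h]
  exact (isOpen_setOf_exists_isAdaptedPair fun x y => (HasCoordinatesIn.const _ y).rightMul
    ((HasCoordinatesIn.const _ x).rightMul (.const _ y))).preimage continuous_subtype_val

theorem isOpen_orbitInVariety_mu3 (hn : 2 ≤ n) : IsOpen (mu3 n).orbitInVariety := by
  have h : (mu3 n).orbitInVariety = Subtype.val ⁻¹'
      {l | ∃ x y, l.IsAdaptedPair x y ∧ l.rightMul (l.rightMul x y) y ≠ 0} :=
    Set.ext fun l => mem_orbit_mu3_iff l.2 hn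
  rw [h]
  exact (isOpen_setOf_exists_isAdaptedPair fun x y =>
    ((HasCoordinatesIn.const _ x).rightMul (.const _ y)).rightMul
      (.const _ y)).preimage continuous_subtype_val

theorem Law.closure_orbitInVariety_mem_irreducibleComponents {n m : ℕ} {l : Law n m}
    (hl : l ∈ nilpotentVariety n m) (hopen : IsOpen l.orbitInVariety) :
    closure l.orbitInVariety ∈ irreducibleComponents (nilpotentVariety n m) :=
  closure_mem_irreducibleComponents_of_isOpen hopen
    (Law.isIrreducible_orbitInVariety (Law.orbit_subset_nilpotentVariety hl))

end Rigidity

end LeibnizSuper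

open LeibnizSuper in
theorem theorem4p8 (n : ℕ) (hn : 2 ≤ n) :
    ((mu2 n).orbit ⊆ nilpotentVariety (n + 1) 2 ∧
      IsOpen (mu2 n).orbitInVariety ∧
      closure (mu2 n).orbitInVariety ∈ irreducibleComponents (nilpotentVariety (n + 1) 2)) ∧
    ((mu3 n).orbit ⊆ nilpotentVariety (n + 1) 2 ∧
      IsOpen (mu3 n).orbitInVariety ∧
      closure (mu3 n).orbitInVariety ∈ irreducibleComponents (nilpotentVariety (n + 1) 2)) := by
  have mem₂ := mu2_mem_nilpotentVariety hn
  have mem₃ := mu3_mem_nilpotentVariety hn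
  have open₂ := isOpen_orbitInVariety_mu2 hn
  have open₃ := isOpen_orbitInVariety_mu3 hn
  exact ⟨⟨Law.orbit_subset_nilpotentVariety mem₂, open₂,
      Law.closure_orbitInVariety_mem_irreducibleComponents mem₂ open₂⟩,
    ⟨Law.orbit_subset_nilpotentVariety mem₃, open₃,
      Law.closure_orbitInVariety_mem_irreducibleComponents mem₃ open₃⟩⟩
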